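/- Let $M\subset\mathbb R^d$ be a compact embedded smooth $m$-dimensional submanifold with smooth (possibly empty) boundary, with the Riemannian metric induced from $\mathbb R^d$ and its volume measure $V$. Let $N\supseteq M$ be an embedded smooth $m$-dimensional submanifold without boundary (for instance $N=M$ if $\partial M=\emptyset$, and an extension of $M$ slightly beyond its boundary otherwise); normal coordinates about a point $y\in M$ are the normal coordinates of $N$, i.e. the components, in an orthonormal basis of $T_yN$, of the shortest $v\in T_yN$ with $\exp_y v=x$. For $h>0$ and $y\in M$ put $\mathcal N_y=\{x\in M:\|x-y\|<h\}$, with the Euclidean distance of $\mathbb R^d$, and let $\mathcal P^k_y\subset L^2(\mathcal N_y)$ be the space of polynomials of degree at most $k$ in the normal coordinates about $y$. Functions on $\mathcal N_y$ are extended by zero to $M$. Let $$Q^{LTSA}_y f = f|_{\mathcal N_y}-H_yf,\qquad H_y=\text{orthogonal projection onto }\mathcal P^1_y,$$ $$Q^{HLLE}_y = \text{orthogonal projection onto the orthogonal complement of }\mathcal P^1_y\text{ in }\mathcal P^2_y$$ (the span of what is left when the monomials of degree at most two are orthonormalized in order of degree and the vectors that come from those of degree at most one are discarded). Let $\alpha_h=O(h^{-4})$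 as $h\to0^+$ (for instance $\alpha_h=h^{-4}$), let $\mathrm{Vol}_h$ be the volume of a ball of radius $h$ in $\mathbb R^m$, and define the continuous extensions of Local Tangent Space Alignment (LTSA) and Hessian Locally Linear Embedding (HLLE) by the $L^2(M)$-valued integrals $$L_h^{LTSA}f=\frac{\alpha_h}{\mathrm{Vol}_h}\int_M Q^{LTSA}_y f\,dV(y),\qquad L_h^{HLLE}f=\frac{\alpha_h}{\mathrm{Vol}_h}\int_M Q^{HLLE}_y f\,dV(y).$$ Then for every $f\in C^\infty(M)$ these integrals converge for all sufficiently small $h>0$, and $L_h^{LTSA}-L_h^{HLLE}\to0$ as $h\to0^+$ in the weak operator topology of $C^\infty(M)$ with the $L^2$ inner product: for all $f,g\in C^\infty(M)$, $$\langle g,\,(L_h^{LTSA}-L_h^{HLLE})f\rangle_{L^2(M)}\longrightarrow0 .$$ Consequently, for all $f,g\in C^\infty(M)$ and $\ell\in\mathbb R$, $\langle g,L_h^{LTSA}f\rangle\to\ell$ if and only if $\langle g,L_h^{HLLE}f\rangle\to\ell$. -/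

import Mathlib

open Set Filter Topology MeasureTheory
open scoped ContDiff InnerProductSpace

noncomputable section

namespace ManifoldLearning

/-- The ambient Euclidean space `ℝ^d`. -/
abbrev Amb (d : ℕ) : Type := EuclideanSpace ℝ (Fin d)

variable {d : ℕ}

/-! ### Embedded submanifolds of `ℝ^d` -/

/-- `Φ` is a smooth diffeomorphism between open subsets of `ℝ^d`. -/
def IsSmoothDiffeo (Φ : OpenPartialHomeomorph (Amb d) (Amb d)) : Prop :=
  ContDiffOn ℝ ∞ Φ Φ.source ∧ ContDiffOn ℝ ∞ Φ.symm Φ.target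

/-- The model `m`-plane `{z | z_i = 0 for i ≥ m}` in `ℝ^d`. -/
def slice (d m : ℕ) : Set (Amb d) :=
  {z | ∀ i : Fin d, m ≤ (i : ℕ) → z i = 0}

/-- The model `m`-dimensional half-space `{z | z_0 ≥ 0 and z_i = 0 for i ≥ m}` in `ℝ^d`. -/
def halfSlice (d m : ℕ) : Set (Amb d) :=
  {z | z ∈ slice d m ∧ ∀ i : Fin d, (i : ℕ) = 0 → 0 ≤ z i}

/-- `N` is an embedded smooth `m`-dimensional submanifold (without boundary) of `ℝ^d`:
locally, a diffeomorphism of the ambient space straightens it to an `m`-plane. -/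
def IsSubmanifold (m : ℕ) (N : Set (Amb d)) : Prop :=
  m ≤ d ∧ ∀ x ∈ N, ∃ Φ : OpenPartialHomeomorph (Amb d) (Amb d),
    IsSmoothDiffeo Φ ∧ x ∈ Φ.source ∧ ∀ z ∈ Φ.source, z ∈ N ↔ Φ z ∈ slice d m

/-- `M` is an embedded smooth `m`-dimensional submanifold of `ℝ^d` with smooth (possibly empty)
boundary: locally, a diffeomorphism of the ambient space straightens it to an `m`-plane or
to an `m`-dimensional half-space. -/
def IsSubmanifoldWithBoundary (m : ℕ) (M : Set (Amb d)) : Prop :=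
  m ≤ d ∧ ∀ x ∈ M, ∃ Φ : OpenPartialHomeomorph (Amb d) (Amb d),
    IsSmoothDiffeo Φ ∧ x ∈ Φ.source ∧
      ((∀ z ∈ Φ.source, z ∈ M ↔ Φ z ∈ slice d m) ∨
        (∀ z ∈ Φ.source, z ∈ M ↔ Φ z ∈ halfSlice d m))

/-- `f` restricts to an element of `C^∞(M)` (smooth up to the boundary): near each point of `M`
it agrees on `M` with a smooth function on an open subset of `ℝ^d`. The values of `f` off `M`
play no role. -/
def SmoothOnSet (M : Set (Amb d)) (f : Amb d → ℝ) : Prop :=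
  ∀ x ∈ M, ∃ U : Set (Amb d), IsOpen U ∧ x ∈ U ∧
    ∃ F : Amb d → ℝ, ContDiffOn ℝ ∞ F U ∧ EqOn f F (U ∩ M)

/-- The tangent space `T_x N`, as a linear subspace of `ℝ^d`. -/
def tangentSpaceAt (N : Set (Amb d)) (x : Amb d) : Submodule ℝ (Amb d) :=
  Submodule.span ℝ (tangentConeAt ℝ N x)

/-- The Riemannian volume measure of an `m`-dimensional submanifold `M` (for the metric induced
from `ℝ^d`): `m`-dimensional Hausdorff measure on `M`, normalized to agree with Lebesgue
measure on `ℝ^m`. -/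
def vol (m : ℕ) (M : Set (Amb d)) : Measure (Amb d) :=
  (μHE[m] : Measure (Amb d)).restrict M

/-! ### Geodesics and normal coordinates -/

/-- `γ : [0,1] → N` is a geodesic with velocity `γ'` for the metric induced from `ℝ^d`: its
acceleration is everywhere orthogonal to `N`. -/
def IsGeodesic (N : Set (Amb d)) (γ γ' : ℝ → Amb d) : Prop :=
  ∀ t ∈ Icc (0 : ℝ) 1, γ t ∈ N ∧ HasDerivWithinAt γ (γ' t) (Icc 0 1) t ∧
    ∃ a ∈ (tangentSpaceAt N (γ t))ᗮ, HasDerivWithinAt γ' a (Icc 0 1) t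

/-- The set of `v ∈ T_y N` with `exp_y v = x`. -/
def expFiber (N : Set (Amb d)) (y x : Amb d) : Set (Amb d) :=
  {v | ∃ γ γ' : ℝ → Amb d, IsGeodesic N γ γ' ∧ γ 0 = y ∧ γ' 0 = v ∧ γ 1 = x}

open Classical in
/-- The normal coordinate vector of `x` at `y`: the vector `v` of least norm with `exp_y v = x`
(for `y` in a compact subset of `N` and `x ∈ N` near enough to `y` it exists and is unique). The
normal coordinates of `x` at `y` are the components of this element of `T_y N ⊆ ℝ^d` in an
orthonormal basis of `T_y N`. -/
def normalCoord (N : Set (Amb d)) (y x : Amb d) : Amb d :=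
  if h : ∃ v ∈ expFiber N y x, ∀ w ∈ expFiber N y x, ‖v‖ ≤ ‖w‖ then h.choose else 0

/-! ### Local polynomial regression -/

/-- The real Hilbert space `L²(M)`. -/
abbrev L2 (m : ℕ) (M : Set (Amb d)) : Type := Lp ℝ 2 (vol m M)

/-- A polynomial in the normal coordinates at `y`, set to zero off the neighborhood `B(y, h)`.
Here `p` is a polynomial on `ℝ^d`, evaluated at normal coordinate vectors in `T_y N`, and the
restrictions to `T_y N` of the polynomials of degree at most `k` on `ℝ^d` are exactly the
polynomials of degree at most `k` in linear coordinates of `T_y N`. -/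
def localPolyFun (N : Set (Amb d)) (h : ℝ) (y : Amb d) (p : MvPolynomial (Fin d) ℝ) :
    Amb d → ℝ :=
  (Metric.ball y h).indicator fun x => MvPolynomial.eval (normalCoord N y x) p

/-- The subspace of `L²(M)` of the polynomials of degree at most `k` in the normal coordinates
at `y`, on the neighborhood `B(y, h) ∩ M` and extended by zero. -/
def polySpace (m : ℕ) (M N : Set (Amb d)) (h : ℝ) (k : ℕ) (y : Amb d) :
    Submodule ℝ (L2 m M) where
  carrier := {F | ∃ p ∈ MvPolynomial.restrictTotalDegree (Fin d) ℝ k,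
    F =ᵐ[vol m M] localPolyFun N h y p}
  zero_mem' := ⟨0, Submodule.zero_mem _, by
    filter_upwards [Lp.coeFn_zero ℝ 2 (vol m M)] with x hx
    rw [hx]
    simp [localPolyFun]⟩
  add_mem' := by
    rintro F G ⟨p, hp, hF⟩ ⟨q, hq, hG⟩
    refine ⟨p + q, Submodule.add_mem _ hp hq, ?_⟩
    filter_upwards [Lp.coeFn_add F G, hF, hG] with x hx h1 h2
    by_cases hb : x ∈ Metric.ball y h <;>
      simp_all [localPolyFun, Set.indicator]
  smul_mem' := by
    rintro c F ⟨p, hp, hF⟩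
    refine ⟨c • p, Submodule.smul_mem _ c hp, ?_⟩
    filter_upwards [Lp.coeFn_smul c F, hF] with x hx h1
    by_cases hb : x ∈ Metric.ball y h <;>
      simp_all [localPolyFun, Set.indicator, MvPolynomial.smul_eval]

theorem localPolyFun_add (N : Set (Amb d)) (h : ℝ) (y : Amb d) (p q : MvPolynomial (Fin d) ℝ) :
    localPolyFun N h y (p + q) = localPolyFun N h y p + localPolyFun N h y q := by
  ext x
  by_cases hb : dist x y < h <;> simp [hb, localPolyFun, Set.indicator]

theorem localPolyFun_smul (N : Set (Amb d)) (h : ℝ) (y : Amb d) (c : ℝ)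
    (p : MvPolynomial (Fin d) ℝ) :
    localPolyFun N h y (c • p) = c • localPolyFun N h y p := by
  ext x
  by_cases hb : dist x y < h <;>
    simp [hb, localPolyFun, Set.indicator, MvPolynomial.smul_eval]

instance polySpace_finiteDimensional (m : ℕ) (M N : Set (Amb d)) (h : ℝ) (k : ℕ) (y : Amb d) :
    FiniteDimensional ℝ (polySpace m M N h k y) := by
  let S : Submodule ℝ (MvPolynomial.restrictTotalDegree (Fin d) ℝ k) :=
    { carrier := {p | MemLp (localPolyFun N h y p) 2 (vol m M)}
      zero_mem' := by
        have h0 : localPolyFun N h y 0 = 0 := by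
          ext x
          simp [localPolyFun]
        simp [h0]
      add_mem' := by
        intro p q hp hq
        simp only [Set.mem_ofPred_eq, Submodule.coe_add, localPolyFun_add] at *
        exact hp.add hq
      smul_mem' := by
        intro c p hp
        simp only [Set.mem_ofPred_eq, Submodule.coe_smul, localPolyFun_smul] at *
        exact hp.const_smul c }
  let T : S →ₗ[ℝ] L2 m M :=
    { toFun := fun p => MemLp.toLp (localPolyFun N h y p) p.2
      map_add' := by
        intro p q
        rw [← MemLp.toLp_add]
        congr 1
        exact localPolyFun_add N h y _ _
      map_smul' := by
        intro c p
        rw [RingHom.id_apply, ← MemLp.toLp_const_smul]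
        congr 1
        exact localPolyFun_smul N h y _ _ }
  refine Submodule.finiteDimensional_of_le (S₂ := LinearMap.range T) ?_
  rintro F ⟨p, hp, hF⟩
  have hm : MemLp (localPolyFun N h y p) 2 (vol m M) := (memLp_congr_ae hF).1 (Lp.memLp F)
  refine ⟨⟨⟨p, hp⟩, hm⟩, ?_⟩
  exact (Lp.ext (hF.trans hm.coeFn_toLp.symm)).symm

/-- Multiplication by the indicator of `B(y, h)`: the operator `I` of the neighborhood of `y`,
extended by zero. -/
def restrictBall (m : ℕ) (M : Set (Amb d)) (h : ℝ) (y : Amb d) (f : L2 m M) : L2 m M :=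
  ((Lp.memLp f).indicator (measurableSet_ball (x := y) (ε := h))).toLp _

/-- The local operator of LTSA, `Q_y = I - H_y`, with `H_y` the hat operator of the least squares
regression on constant and linear functions of the normal coordinates at `y`, on the
neighborhood `B(y, h) ∩ M`. -/
def localLTSA (m : ℕ) (M N : Set (Amb d)) (h : ℝ) (y : Amb d) (f : L2 m M) : L2 m M :=
  restrictBall m M h y f - (polySpace m M N h 1 y).starProjection f

/-- The local operator of HLLE: orthonormalize the monomials of degree at most two in normal
coordinates at `y` in order of degree, discard the ones that come from constant and linear
functions, and project onto the span of the others, which is the orthogonal complement of the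
polynomials of degree at most one in those of degree at most two. -/
def localHLLE (m : ℕ) (M N : Set (Amb d)) (h : ℝ) (y : Amb d) (f : L2 m M) : L2 m M :=
  (polySpace m M N h 2 y ⊓ (polySpace m M N h 1 y)ᗮ).starProjection f

/-! ### Continuous extensions -/

/-- The volume of a ball of radius `h` in `ℝ^m`. -/
def volBall (m : ℕ) (h : ℝ) : ℝ :=
  (volume (Metric.ball (0 : EuclideanSpace ℝ (Fin m)) h)).toReal

/-- The continuous extension of LTSA, `L_h f = (α_h / Vol_h) ∫_M Q_y f dV(y)`, an integral in
`L²(M)`. -/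
def opLTSA (m : ℕ) (M N : Set (Amb d)) (α : ℝ → ℝ) (h : ℝ) (f : L2 m M) : L2 m M :=
  (α h / volBall m h) • ∫ y, localLTSA m M N h y f ∂(vol m M)

/-- The continuous extension of HLLE. -/
def opHLLE (m : ℕ) (M N : Set (Amb d)) (α : ℝ → ℝ) (h : ℝ) (f : L2 m M) : L2 m M :=
  (α h / volBall m h) • ∫ y, localHLLE m M N h y f ∂(vol m M)

end ManifoldLearning

end

open ManifoldLearning

/-! The degree-one regressions cancel in the difference of the local operators: with `H²_y` the
projection onto the polynomials of degree at most two, `Q^{LTSA}_y - Q^{HLLE}_y = I - H²_y` on the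
neighborhood of `y` (`localLTSA_sub_localHLLE`). This is again an orthogonal projection, so its
matrix entry against `g` sees both functions only modulo quadratic polynomials: it is at most `‖g -
q‖ ‖f - p‖` for any such `p`, `q` (`abs_inner_residual_le`). Smooth functions agree with quadratic
polynomials in normal coordinates up to `O(h³)`, so each factor is `O(h³ √Vol_h)` and the entry is
`O(h⁶ Vol_h)`, uniformly in `y` (`exists_abs_inner_local_sub_le`). The factor `α_h / Vol_h` leaves
`O(h²)` after integration over `y`. Only upper bounds occur, so the boundary of `M` needs no
separate treatment.

The geometric input is control of normal coordinates near the diagonal. Geodesics are described by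
two equations of the form `γ'' = B(γ)(γ', γ')`. In the ambient space, differentiating `γ' = P(γ) γ'`
for a smooth extension `P` of the tangent projection gives an equation that every short geodesic
solves; comparing solutions yields uniqueness and Lipschitz dependence
(`exists_expFiber_lipschitz`). In a chart, solving the equation produces geodesics between nearby
points (`exists_mem_expFiber`). Together they give `exists_ball_normalCoord`, and Taylor's formula
along geodesics gives the cubic error.

The `L²`-valued integrals exist because the local projections are bounded and depend measurably on
`y`, by Gram-Schmidt applied to a measurable spanning family. -/

namespace ManifoldLearning

/-! ### Comparison of slow solutions of quadratic second order equations. -/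

section Quadratic

variable {V W : Type*} [NormedAddCommGroup V] [NormedSpace ℝ V]
  [NormedAddCommGroup W] [NormedSpace ℝ W]

/-- A `C¹` map is bounded and Lipschitz near each point, with one constant for both. -/
theorem exists_ball_lipschitz_bound {f : V → W} {x : V} (hf : ContDiffAt ℝ 1 f x) :
    ∃ r > 0, ∃ K > 0, (∀ z ∈ Metric.ball x r, ‖f z‖ ≤ K) ∧
      ∀ z₁ ∈ Metric.ball x r, ∀ z₂ ∈ Metric.ball x r, ‖f z₁ - f z₂‖ ≤ K * ‖z₁ - z₂‖ := by
  obtain ⟨K, t, ht, hK⟩ := hf.exists_lipschitzOnWith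
  have hb : ∀ᶠ z in 𝓝 x, ‖f z‖ < ‖f x‖ + 1 :=
    hf.continuousAt.norm.eventually_lt continuousAt_const (by simp)
  obtain ⟨r, hr, hrt⟩ := Metric.mem_nhds_iff.1 (inter_mem ht hb)
  refine ⟨r, hr, K + (‖f x‖ + 1), by positivity, fun z hz => ?_, fun z₁ h₁ z₂ h₂ => ?_⟩
  · have := (hrt hz).2
    simp only [mem_ofPred_eq] at this
    linarith [K.2]
  · refine (hK.norm_sub_le (hrt h₁).1 (hrt h₂).1).trans ?_
    gcongr
    linarith [norm_nonneg (f x)]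

/-- Difference of the values of two quadratic forms at two vectors. -/
theorem norm_quadratic_sub_le (B₁ B₂ : V →L[ℝ] V →L[ℝ] W) {K D : ℝ} (h₂ : ‖B₂‖ ≤ K)
    (hB : ‖B₁ - B₂‖ ≤ K * D) (w₁ w₂ : V) :
    ‖B₁ w₁ w₁ - B₂ w₂ w₂‖ ≤ K * D * ‖w₁‖ ^ 2 + K * (‖w₁‖ + ‖w₂‖) * ‖w₁ - w₂‖ := by
  have e : B₁ w₁ w₁ - B₂ w₂ w₂ =
      (B₁ - B₂) w₁ w₁ + (B₂ w₁ (w₁ - w₂) + B₂ (w₁ - w₂) w₂) := by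
    simp only [map_sub, _root_.sub_apply]
    abel
  have b (B : V →L[ℝ] V →L[ℝ] W) {k : ℝ} (hk : ‖B‖ ≤ k) (x y : V) :
      ‖B x y‖ ≤ k * ‖x‖ * ‖y‖ :=
    (B.le_opNorm₂ x y).trans (by gcongr)
  rw [e]
  refine (norm_add_le _ _).trans (add_le_add ?_ ((norm_add_le _ _).trans ?_))
  · exact (b _ hB _ _).trans_eq (by ring)
  · exact (add_le_add (b _ h₂ _ _) (b _ h₂ _ _)).trans_eq (by ring)

/-- `γ : [0,1] → S` solves `γ'' = B(γ)(γ', γ')` with velocity `γ'` of norm at most `ε`. -/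
def SolvesQuadratic (B : V → V →L[ℝ] V →L[ℝ] V) (S : Set V) (ε : ℝ) (γ γ' : ℝ → V) : Prop :=
  ∀ t ∈ Icc (0 : ℝ) 1, HasDerivWithinAt γ (γ' t) (Icc 0 1) t ∧
    HasDerivWithinAt γ' (B (γ t) (γ' t) (γ' t)) (Icc 0 1) t ∧ γ t ∈ S ∧ ‖γ' t‖ ≤ ε

theorem norm_sub_zero_le_of_deriv {f f' : ℝ → V} {C : ℝ}
    (hf : ∀ t ∈ Icc (0 : ℝ) 1, HasDerivWithinAt f (f' t) (Icc 0 1) t)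
    (hb : ∀ t ∈ Icc (0 : ℝ) 1, ‖f' t‖ ≤ C) {t : ℝ} (ht : t ∈ Icc (0 : ℝ) 1) :
    ‖f t - f 0‖ ≤ C := by
  have hC : 0 ≤ C := (norm_nonneg _).trans (hb t ht)
  have := norm_image_sub_le_of_norm_deriv_le_segment' hf
    (fun x hx => hb x (Ico_subset_Icc_self hx)) t ht
  nlinarith [ht.2]

/-- Two slow solutions of `γ'' = B(γ)(γ', γ')`: the difference of the initial velocities is
nearly determined by the difference of the end points. -/
theorem SolvesQuadratic.norm_velocity_sub_le {B : V → V →L[ℝ] V →L[ℝ] V} {S : Set V}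
    {K ε κ : ℝ} (hK : ∀ z ∈ S, ‖B z‖ ≤ K)
    (hL : ∀ z₁ ∈ S, ∀ z₂ ∈ S, ‖B z₁ - B z₂‖ ≤ K * ‖z₁ - z₂‖)
    (hκ : K * (ε ^ 2 + 2 * ε) ≤ κ) (hκ4 : κ ≤ 1 / 4)
    {γ₁ γ₁' γ₂ γ₂' : ℝ → V} (h₁ : SolvesQuadratic B S ε γ₁ γ₁')
    (h₂ : SolvesQuadratic B S ε γ₂ γ₂') :
    ‖(γ₁ 1 - γ₂ 1) - (γ₁ 0 - γ₂ 0) - (γ₁' 0 - γ₂' 0)‖ ≤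
      2 * κ * (‖γ₁ 0 - γ₂ 0‖ + ‖γ₁' 0 - γ₂' 0‖) := by
  have z0 : (0 : ℝ) ∈ Icc (0 : ℝ) 1 := by simp
  have z1 : (1 : ℝ) ∈ Icc (0 : ℝ) 1 := by simp
  have hε : 0 ≤ ε := (norm_nonneg _).trans (h₁ 0 z0).2.2.2
  have hK0 : 0 ≤ K := (norm_nonneg (B (γ₁ 0))).trans (hK _ (h₁ 0 z0).2.2.1)
  have hκ0 : 0 ≤ κ := le_trans (by positivity) hκ
  set δ : ℝ → V := fun t => γ₁ t - γ₂ t with hδ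
  set e : ℝ → V := fun t => γ₁' t - γ₂' t with he
  have dδ : ∀ t ∈ Icc (0 : ℝ) 1, HasDerivWithinAt δ (e t) (Icc 0 1) t :=
    fun t ht => (h₁ t ht).1.sub (h₂ t ht).1
  have de : ∀ t ∈ Icc (0 : ℝ) 1, HasDerivWithinAt e
      (B (γ₁ t) (γ₁' t) (γ₁' t) - B (γ₂ t) (γ₂' t) (γ₂' t)) (Icc 0 1) t :=
    fun t ht => (h₁ t ht).2.1.sub (h₂ t ht).2.1
  have ce : ContinuousOn (fun t => ‖e t‖) (Icc 0 1) :=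
    fun t ht => (de t ht).continuousWithinAt.norm
  -- The maximum of `‖e‖` takes the place of a Grönwall argument: it is bounded in terms of itself
  -- with factor `κ ≤ 1/4`, and that term is absorbed at the end.
  obtain ⟨s, hs, hmax⟩ := isCompact_Icc.exists_isMaxOn ⟨0, z0⟩ ce
  have hS : ∀ t ∈ Icc (0 : ℝ) 1, ‖e t‖ ≤ ‖e s‖ := fun t ht => hmax ht
  have bδ : ∀ t ∈ Icc (0 : ℝ) 1, ‖δ t‖ ≤ ‖δ 0‖ + ‖e s‖ := fun t ht =>
    (norm_le_insert' (δ t) (δ 0)).trans (by gcongr; exact norm_sub_zero_le_of_deriv dδ hS ht)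
  have be : ∀ t ∈ Icc (0 : ℝ) 1, ‖B (γ₁ t) (γ₁' t) (γ₁' t) - B (γ₂ t) (γ₂' t) (γ₂' t)‖ ≤
      κ * (‖δ 0‖ + ‖e s‖) := by
    intro t ht
    obtain ⟨-, -, m₁, b₁⟩ := h₁ t ht
    obtain ⟨-, -, m₂, b₂⟩ := h₂ t ht
    refine (norm_quadratic_sub_le _ _ (hK _ m₂) (hL _ m₁ _ m₂) _ _).trans ?_
    have a1 : K * ‖γ₁ t - γ₂ t‖ * ‖γ₁' t‖ ^ 2 ≤ K * (‖δ 0‖ + ‖e s‖) * ε ^ 2 := by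
      gcongr
      exact bδ t ht
    have a2 : K * (‖γ₁' t‖ + ‖γ₂' t‖) * ‖γ₁' t - γ₂' t‖ ≤
        K * (ε + ε) * (‖δ 0‖ + ‖e s‖) := by
      gcongr
      exact (hS t ht).trans (by simp)
    nlinarith [mul_le_mul_of_nonneg_right hκ (by positivity : 0 ≤ ‖δ 0‖ + ‖e s‖)]
  have ee : ∀ t ∈ Icc (0 : ℝ) 1, ‖e t - e 0‖ ≤ κ * (‖δ 0‖ + ‖e s‖) :=
    fun t ht => norm_sub_zero_le_of_deriv de be ht
  have hes : ‖e s‖ ≤ ‖e 0‖ + κ * (‖δ 0‖ + ‖e s‖) :=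
    (norm_le_insert' (e s) (e 0)).trans (by gcongr; exact ee s hs)
  -- Removing the uniform motion with velocity `e 0` leaves a curve whose derivative is the small
  -- quantity `e t - e 0`.
  have dl : ∀ t ∈ Icc (0 : ℝ) 1,
      HasDerivWithinAt (fun t => δ t - t • e 0) (e t - e 0) (Icc 0 1) t := by
    intro t ht
    convert! (dδ t ht).sub ((hasDerivWithinAt_id t (Icc (0 : ℝ) 1)).smul_const (e 0)) using 1
    simp
  have key := norm_sub_zero_le_of_deriv dl ee z1
  have key' : ‖δ 1 - δ 0 - e 0‖ ≤ κ * (‖δ 0‖ + ‖e s‖) := by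
    refine le_of_eq_of_le ?_ key
    congr 1
    simp only [one_smul, zero_smul, sub_zero]
    abel
  refine key'.trans ?_
  have n1 := norm_nonneg (δ 0)
  have n2 := norm_nonneg (e s)
  have n3 := norm_nonneg (e 0)
  have : ‖e s‖ ≤ ‖δ 0‖ + 2 * ‖e 0‖ := by nlinarith
  change κ * (‖δ 0‖ + ‖e s‖) ≤ 2 * κ * (‖δ 0‖ + ‖e 0‖)
  nlinarith

/-- Second order Taylor formula on `[0,1]`. -/
theorem abs_taylor_two_le {φ φ' φ'' : ℝ → ℝ} {C : ℝ}
    (h₁ : ∀ t ∈ Icc (0 : ℝ) 1, HasDerivWithinAt φ (φ' t) (Icc 0 1) t)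
    (h₂ : ∀ t ∈ Icc (0 : ℝ) 1, HasDerivWithinAt φ' (φ'' t) (Icc 0 1) t)
    (hC : ∀ t ∈ Icc (0 : ℝ) 1, |φ'' t - φ'' 0| ≤ C) :
    |φ 1 - (φ 0 + φ' 0 + φ'' 0 / 2)| ≤ C := by
  have d2 : ∀ t ∈ Icc (0 : ℝ) 1,
      HasDerivWithinAt (fun t => φ' t - t * φ'' 0) (φ'' t - φ'' 0) (Icc 0 1) t := by
    intro t ht
    convert! (h₂ t ht).sub ((hasDerivWithinAt_id t (Icc (0 : ℝ) 1)).mul_const (φ'' 0)) using 1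
    simp
  have b2 : ∀ t ∈ Icc (0 : ℝ) 1, ‖φ' t - φ' 0 - t * φ'' 0‖ ≤ C := by
    intro t ht
    have := norm_sub_zero_le_of_deriv d2 hC ht
    rwa [zero_mul, sub_zero, sub_right_comm] at this
  have d1 : ∀ t ∈ Icc (0 : ℝ) 1, HasDerivWithinAt
      (fun t => φ t - t * φ' 0 - t ^ 2 / 2 * φ'' 0) (φ' t - φ' 0 - t * φ'' 0) (Icc 0 1) t := by
    intro t ht
    have a := (hasDerivWithinAt_id t (Icc (0 : ℝ) 1)).mul_const (φ' 0)
    have b := (((hasDerivWithinAt_id t (Icc (0 : ℝ) 1)).pow 2).div_const 2).mul_const (φ'' 0)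
    convert! ((h₁ t ht).sub a).sub b using 1
    simp
  have := norm_sub_zero_le_of_deriv d1 b2 (t := 1) (by simp)
  convert! this using 1
  rw [Real.norm_eq_abs]
  congr 1
  ring

end Quadratic

/-! ### Existence of solutions with given initial data or given end points. -/

section Existence

variable {E : Type*} [NormedAddCommGroup E] [NormedSpace ℝ E] [CompleteSpace E]

/-- Local existence, uniform in the initial data, for `u'' = G(u)(u', u')` on `[0,1]`. -/
theorem exists_solvesQuadratic {G : E → E →L[ℝ] E →L[ℝ] E} {a₀ : E} (hG : ContDiffAt ℝ 1 G a₀)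
    {η : ℝ} (hη : 0 < η) :
    ∃ r > 0, ∀ a ∈ Metric.ball a₀ r, ∀ w : E, ‖w‖ ≤ r →
      ∃ u u' : ℝ → E, SolvesQuadratic G (Metric.ball a₀ η) η u u' ∧ u 0 = a ∧ u' 0 = w := by
  set F : E × E → E × E := fun p => (p.2, G p.1 p.2 p.2) with hF
  have hFc : ContDiffAt ℝ 1 F (a₀, 0) := by
    have h1 : ContDiffAt ℝ 1 (fun p : E × E => G p.1) (a₀, 0) :=
      ContDiffAt.comp (g := G) (f := Prod.fst) (a₀, (0 : E)) hG contDiffAt_fst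
    exact contDiffAt_snd.prodMk ((h1.clm_apply contDiffAt_snd).clm_apply contDiffAt_snd)
  obtain ⟨τ, hτ, A, ρ, L, K, hρ, hpl⟩ := IsPicardLindelof.of_contDiffAt_one hFc
  obtain ⟨Y, hY, hYc⟩ := (hpl 0).exists_forall_mem_closedBall_eq_hasDerivWithinAt_continuousOn
  have hz : Y ((a₀, 0), 0) = (a₀, 0) := (hY _ (by simp)).1
  have hnhds : Metric.closedBall ((a₀, 0) : E × E) ρ ×ˢ Icc (0 - τ) (0 + τ) ∈
      𝓝 (((a₀, 0), 0) : (E × E) × ℝ) :=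
    prod_mem_nhds (Metric.closedBall_mem_nhds _ hρ) (Icc_mem_nhds (by linarith) (by linarith))
  have hca : ContinuousAt Y ((a₀, 0), 0) := hYc.continuousAt hnhds
  have hev : ∀ᶠ p in 𝓝 (((a₀, 0), 0) : (E × E) × ℝ), Y p ∈ Metric.ball ((a₀, 0) : E × E) η := by
    refine hca.eventually_mem ?_
    rw [hz]
    exact Metric.ball_mem_nhds _ hη
  obtain ⟨σ, hσ, hσs⟩ := Metric.mem_nhds_iff.1 (inter_mem hnhds hev)
  -- Homogeneity: if `(x, v)` solves the first order system, so does `(x(εt), ε v(εt))`. A short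
  -- time interval is thus traded for small initial velocities and a solution on all of `[0,1]`.
  set ε : ℝ := min (σ / 2) 1 with hε
  have hε0 : 0 < ε := by positivity
  have hε1 : ε ≤ 1 := min_le_right _ _
  have hεσ : ε < σ := (min_le_left _ _).trans_lt (by linarith)
  -- The radius `ε²` makes the rescaled velocity `ε⁻¹ • w` have norm at most `ε < σ`.
  refine ⟨ε * ε, by positivity, fun a ha w hw => ?_⟩
  have ha' : dist a a₀ < σ := (Metric.mem_ball.1 ha).trans (by nlinarith)
  have hw' : ‖ε⁻¹ • w‖ < σ := by
    rw [norm_smul, norm_inv, Real.norm_of_nonneg hε0.le]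
    have : ε⁻¹ * ‖w‖ ≤ ε⁻¹ * (ε * ε) := by gcongr
    rw [inv_mul_cancel_left₀ hε0.ne'] at this
    linarith
  have hmem : ∀ t ∈ Icc (0 : ℝ) 1, ((a, ε⁻¹ • w), ε * t) ∈
      Metric.ball (((a₀, 0), 0) : (E × E) × ℝ) σ := by
    intro t ht
    rw [← ball_prod_same, ← ball_prod_same]
    refine ⟨⟨ha', by simpa using hw'⟩, ?_⟩
    have h0 : 0 ≤ ε * t := mul_nonneg hε0.le ht.1
    have : ε * t < σ := by nlinarith [ht.2]
    simpa [abs_of_nonneg hε0.le, abs_of_nonneg ht.1] using this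
  have hx0 : ((a, ε⁻¹ • w) : E × E) ∈ Metric.closedBall ((a₀, 0) : E × E) ρ :=
    (hσs (hmem 0 (by simp))).1.1
  have hder : ∀ t ∈ Icc (0 : ℝ) 1, HasDerivWithinAt (fun t => Y ((a, ε⁻¹ • w), ε * t))
      (ε • F (Y ((a, ε⁻¹ • w), ε * t))) (Icc 0 1) t := by
    intro t ht
    have h1 := (hY _ hx0).2 (ε * t) (hσs (hmem t ht)).1.2
    have h2 : HasDerivWithinAt (fun t : ℝ => ε * t) ε (Icc 0 1) t := by
      simpa using (hasDerivWithinAt_id t (Icc (0 : ℝ) 1)).const_mul ε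
    exact HasDerivWithinAt.scomp t h1 h2 fun s hs => (hσs (hmem s hs)).1.2
  refine ⟨fun t => (Y ((a, ε⁻¹ • w), ε * t)).1, fun t => ε • (Y ((a, ε⁻¹ • w), ε * t)).2,
    fun t ht => ⟨?_, ?_, ?_, ?_⟩, ?_, ?_⟩
  · exact (ContinuousLinearMap.fst ℝ E E).hasFDerivAt.comp_hasDerivWithinAt t (hder t ht)
  · have := ((ContinuousLinearMap.snd ℝ E E).hasFDerivAt.comp_hasDerivWithinAt t
      (hder t ht)).const_smul ε
    convert! this using 1
    simp [hF]
  · have := (hσs (hmem t ht)).2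
    simp only [mem_ofPred_eq, ← ball_prod_same] at this
    exact this.1
  · have := (hσs (hmem t ht)).2
    simp only [mem_ofPred_eq, ← ball_prod_same] at this
    have h2 : ‖(Y ((a, ε⁻¹ • w), ε * t)).2‖ < η := by simpa using this.2
    rw [norm_smul, Real.norm_of_nonneg hε0.le]
    nlinarith [norm_nonneg (Y ((a, ε⁻¹ • w), ε * t)).2]
  · simp only [mul_zero, (hY _ hx0).1]
  · simp only [mul_zero, (hY _ hx0).1]
    rw [smul_inv_smul₀ hε0.ne']

/-- Solutions of `u'' = G(u)(u', u')` join any two points near a given one. -/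
theorem exists_solvesQuadratic_joining {G : E → E →L[ℝ] E →L[ℝ] E} {a₀ : E}
    (hG : ContDiffAt ℝ 1 G a₀) {η : ℝ} (hη : 0 < η) :
    ∃ r > 0, ∀ a ∈ Metric.ball a₀ r, ∀ b ∈ Metric.ball a₀ r,
      ∃ u u' : ℝ → E, SolvesQuadratic G (Metric.ball a₀ η) η u u' ∧ u 0 = a ∧ u 1 = b ∧
        ‖u' 0‖ ≤ 2 * ‖b - a‖ := by
  obtain ⟨ρ, hρ, K, hK0, hK, hL⟩ := exists_ball_lipschitz_bound hG
  obtain ⟨ε, hε0, hεη, hερ, hεK⟩ : ∃ ε > 0, ε ≤ η ∧ ε ≤ ρ ∧ K * (ε ^ 2 + 2 * ε) ≤ 1 / 4 := by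
    -- For `ε ≤ 1` the comparison constant is at most `3Kε`, whence the bound `1 / (12 * K)`.
    refine ⟨min (min η ρ) (min 1 (1 / (12 * K))), by positivity,
      (min_le_left _ _).trans (min_le_left _ _), (min_le_left _ _).trans (min_le_right _ _), ?_⟩
    set ε := min (min η ρ) (min 1 (1 / (12 * K))) with hε
    have h0 : 0 < ε := by positivity
    have h1 : ε ≤ 1 := (min_le_right _ _).trans (min_le_left _ _)
    have h2 : ε ≤ 1 / (12 * K) := (min_le_right _ _).trans (min_le_right _ _)
    rw [le_div_iff₀ (by positivity)] at h2
    nlinarith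
  obtain ⟨r, hr, hex⟩ := exists_solvesQuadratic hG hε0
  choose! u u' hu hu0 hu0' using hex
  have hmono : ∀ {v v' : ℝ → E}, SolvesQuadratic G (Metric.ball a₀ ε) ε v v' →
      SolvesQuadratic G (Metric.ball a₀ η) η v v' := fun h t ht =>
    ⟨(h t ht).1, (h t ht).2.1, Metric.ball_subset_ball hεη (h t ht).2.2.1,
      (h t ht).2.2.2.trans hεη⟩
  have hdiff : ∀ a ∈ Metric.ball a₀ r, ∀ w₁, ‖w₁‖ ≤ r → ∀ w₂, ‖w₂‖ ≤ r →
      ‖u a w₁ 1 - u a w₂ 1 - (w₁ - w₂)‖ ≤ 1 / 2 * ‖w₁ - w₂‖ := by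
    intro a ha w₁ h₁ w₂ h₂
    have := SolvesQuadratic.norm_velocity_sub_le
      (fun z hz => hK z (Metric.ball_subset_ball hερ hz))
      (fun z₁ h₁ z₂ h₂ => hL z₁ (Metric.ball_subset_ball hερ h₁) z₂
        (Metric.ball_subset_ball hερ h₂)) hεK le_rfl (hu a ha w₁ h₁) (hu a ha w₂ h₂)
    rw [hu0 a ha w₁ h₁, hu0 a ha w₂ h₂, hu0' a ha w₁ h₁, hu0' a ha w₂ h₂, sub_self, sub_zero,
      norm_zero, zero_add] at this
    linarith
  -- The solution with zero velocity is compared with the constant curve, which has the same initial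
  -- data.
  have hconst : ∀ a ∈ Metric.ball a₀ r, u a 0 1 = a := by
    intro a ha
    have h0 : ‖(0 : E)‖ ≤ r := by simpa using hr.le
    obtain ⟨-, -, haS, -⟩ := hu a ha 0 h0 0 (by simp)
    rw [hu0 a ha 0 h0] at haS
    have hc : SolvesQuadratic G (Metric.ball a₀ ε) ε (fun _ => a) (fun _ => 0) := fun t _ =>
      ⟨hasDerivWithinAt_const _ _ _, by simpa using hasDerivWithinAt_const t _ (0 : E), haS,
        by simpa using hε0.le⟩
    have := SolvesQuadratic.norm_velocity_sub_le
      (fun z hz => hK z (Metric.ball_subset_ball hερ hz))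
      (fun z₁ h₁ z₂ h₂ => hL z₁ (Metric.ball_subset_ball hερ h₁) z₂
        (Metric.ball_subset_ball hερ h₂)) hεK le_rfl (hu a ha 0 h0) hc
    rw [hu0 a ha 0 h0, hu0' a ha 0 h0] at this
    simpa [sub_eq_zero] using this
  -- By `hdiff` the time-one map is a `1/2`-Lipschitz perturbation of the identity on the ball of
  -- radius `r`, so its image covers the ball of radius `r / 2` about `a`; points within `r / 4` of
  -- `a₀` are at most that far apart.
  refine ⟨r / 4, by positivity, fun a ha b hb => ?_⟩
  have har : a ∈ Metric.ball a₀ r := Metric.ball_subset_ball (by linarith) ha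
  have happ : ApproximatesLinearOn (fun w => u a w 1)
      ((ContinuousLinearEquiv.refl ℝ E : E ≃L[ℝ] E) : E →L[ℝ] E)
      (Metric.closedBall 0 r) (1 / 2) := by
    intro w₁ h₁ w₂ h₂
    simpa using hdiff a har w₁ (by simpa using h₁) w₂ (by simpa using h₂)
  let S : ((ContinuousLinearEquiv.refl ℝ E : E ≃L[ℝ] E) : E →L[ℝ] E).NonlinearRightInverse :=
    { toFun := id
      nnnorm := 1
      bound' := fun y => by simp
      right_inv' := fun y => rfl }
  have hsurj := happ.surjOn_closedBall_of_nonlinearRightInverse S hr.le subset_rfl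
  have hba : ‖b - a‖ ≤ r / 2 := by
    rw [← dist_eq_norm]
    have := dist_triangle_right b a a₀
    have h1 := Metric.mem_ball.1 ha
    have h2 := Metric.mem_ball.1 hb
    linarith
  obtain ⟨w, hw, hwb⟩ := hsurj (a := b) (by
    simp only [hconst a har, mem_closedBall_iff_norm]
    refine hba.trans_eq ?_
    have : (S.nnnorm : ℝ) = 1 := rfl
    rw [this]
    push_cast
    ring)
  have hwr : ‖w‖ ≤ r := by simpa using hw
  refine ⟨u a w, u' a w, hmono (hu a har w hwr), hu0 a har w hwr, hwb, ?_⟩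
  rw [hu0' a har w hwr]
  have h := hdiff a har w hwr 0 (by simpa using hr.le)
  simp only at hwb
  rw [hconst a har, hwb, sub_zero] at h
  have := norm_le_insert (b - a) w
  linarith

end Existence

end ManifoldLearning

namespace ManifoldLearning

/-! ### Local parametrizations and the two forms of the geodesic equation. -/

noncomputable section Parametrization

variable {d m : ℕ}

/-- A smooth local parametrization `ψ` of `N` near a point, with a smooth left inverse `θ`
defined on an open subset of the ambient space. -/
structure Parametrization (m : ℕ) (N : Set (Amb d)) (x₀ : Amb d) where
  ψ : EuclideanSpace ℝ (Fin m) → Amb d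
  θ : Amb d → EuclideanSpace ℝ (Fin m)
  O : Set (EuclideanSpace ℝ (Fin m))
  U : Set (Amb d)
  isOpen_O : IsOpen O
  isOpen_U : IsOpen U
  mem_U : x₀ ∈ U
  contDiffOn_ψ : ContDiffOn ℝ ∞ ψ O
  contDiffOn_θ : ContDiffOn ℝ ∞ θ U
  ψ_mem : ∀ u ∈ O, ψ u ∈ N
  ψ_mem_U : ∀ u ∈ O, ψ u ∈ U
  θ_ψ : ∀ u ∈ O, θ (ψ u) = u
  θ_mem : ∀ z ∈ U, θ z ∈ O
  ψ_θ : ∀ z ∈ U, z ∈ N → ψ (θ z) = z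

/-- The inclusion `ℝ^m → ℝ^d` by zero padding. -/
def padZero (m d : ℕ) : EuclideanSpace ℝ (Fin m) →L[ℝ] Amb d :=
  LinearMap.toContinuousLinearMap
    { toFun := fun u => WithLp.toLp 2 fun i => if h : (i : ℕ) < m then u ⟨i, h⟩ else 0
      map_add' := fun u v => by
        ext i
        by_cases h : (i : ℕ) < m <;> simp [h]
      map_smul' := fun c u => by
        ext i
        by_cases h : (i : ℕ) < m <;> simp [h] }

/-- The projection `ℝ^d → ℝ^m` to the first coordinates. -/
def firstCoords (h : m ≤ d) : Amb d →L[ℝ] EuclideanSpace ℝ (Fin m) :=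
  LinearMap.toContinuousLinearMap
    { toFun := fun z => WithLp.toLp 2 fun j => z (Fin.castLE h j)
      map_add' := fun u v => by
        ext i
        simp
      map_smul' := fun c u => by
        ext i
        simp }

theorem padZero_apply (u : EuclideanSpace ℝ (Fin m)) (i : Fin d) :
    padZero m d u i = if h : (i : ℕ) < m then u ⟨i, h⟩ else 0 := rfl

theorem firstCoords_apply (h : m ≤ d) (z : Amb d) (j : Fin m) :
    firstCoords h z j = z (Fin.castLE h j) := rfl

theorem padZero_mem_slice (u : EuclideanSpace ℝ (Fin m)) : padZero m d u ∈ slice d m := by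
  intro i hi
  simp [padZero_apply, not_lt.2 hi]

theorem firstCoords_padZero (h : m ≤ d) (u : EuclideanSpace ℝ (Fin m)) :
    firstCoords h (padZero m d u) = u := by
  ext j
  simp [firstCoords_apply, padZero_apply]

theorem padZero_firstCoords (h : m ≤ d) {z : Amb d} (hz : z ∈ slice d m) :
    padZero m d (firstCoords h z) = z := by
  ext i
  by_cases hi : (i : ℕ) < m
  · simp [firstCoords_apply, padZero_apply, hi]
  · simp [padZero_apply, hi, hz i (not_lt.1 hi)]

/-- `θ` is the straightening diffeomorphism followed by the first `m` coordinates, and `ψ` its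
inverse on zero-padded vectors. `U` is cut down so that `θ` lands in the domain of `ψ` even at
points off `N`. -/
theorem IsSubmanifold.exists_parametrization {N : Set (Amb d)} (hN : IsSubmanifold m N)
    {x : Amb d} (hx : x ∈ N) : Nonempty (Parametrization m N x) := by
  obtain ⟨hmd, hN⟩ := hN
  obtain ⟨Φ, ⟨hΦ, hΦs⟩, hxs, hΦN⟩ := hN x hx
  have hO : IsOpen (padZero m d ⁻¹' Φ.target) :=
    Φ.open_target.preimage (padZero m d).continuous
  have hθ : ContDiffOn ℝ ∞ (fun z => firstCoords hmd (Φ z)) Φ.source :=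
    (firstCoords hmd).contDiff.comp_contDiffOn hΦ
  have hzO : ∀ z ∈ Φ.source, z ∈ N → padZero m d (firstCoords hmd (Φ z)) = Φ z :=
    fun z hz hzN => padZero_firstCoords hmd ((hΦN z hz).1 hzN)
  have hθψ : ∀ u ∈ padZero m d ⁻¹' Φ.target,
      firstCoords hmd (Φ (Φ.symm (padZero m d u))) = u := fun u hu => by
    rw [Φ.right_inv hu, firstCoords_padZero]
  exact ⟨{
    ψ := fun u => Φ.symm (padZero m d u)
    θ := fun z => firstCoords hmd (Φ z)
    O := padZero m d ⁻¹' Φ.target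
    U := Φ.source ∩ (fun z => firstCoords hmd (Φ z)) ⁻¹' (padZero m d ⁻¹' Φ.target)
    isOpen_O := hO
    isOpen_U := hθ.continuousOn.isOpen_inter_preimage Φ.open_source hO
    mem_U := ⟨hxs, by
      rw [mem_preimage, mem_preimage, hzO x hxs hx]
      exact Φ.map_source hxs⟩
    contDiffOn_ψ := hΦs.comp (padZero m d).contDiff.contDiffOn fun u hu => hu
    contDiffOn_θ := hθ.mono inter_subset_left
    ψ_mem := fun u hu => by
      rw [hΦN _ (Φ.map_target hu), Φ.right_inv hu]
      exact padZero_mem_slice u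
    ψ_mem_U := fun u hu => ⟨Φ.map_target hu, by
      rw [mem_preimage, hθψ u hu]
      exact hu⟩
    θ_ψ := hθψ
    θ_mem := fun z hz => hz.2
    ψ_θ := fun z hz hzN => by rw [hzO z hz.1 hzN, Φ.left_inv hz.1] }⟩

/-- The velocity at an inner or end point of a curve in `N` is tangent to `N`. -/
theorem velocity_mem_tangentSpaceAt {N : Set (Amb d)} {γ : ℝ → Amb d} {v : Amb d} {t : ℝ}
    (hγ : ∀ s ∈ Icc (0 : ℝ) 1, γ s ∈ N) (ht : t ∈ Icc (0 : ℝ) 1)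
    (hv : HasDerivWithinAt γ v (Icc 0 1) t) : v ∈ tangentSpaceAt N (γ t) := by
  have hacc : AccPt t (𝓟 (Icc (0 : ℝ) 1)) :=
    (uniqueDiffWithinAt_iff_accPt).1 (uniqueDiffOn_Icc zero_lt_one t ht)
  -- The tangent cone of `[0,1]` is the whole line even at the end points, so the velocity is the
  -- image of a tangent vector there too.
  have h1 : (1 : ℝ) ∈ tangentConeAt ℝ (Icc (0 : ℝ) 1) t := by
    rw [tangentConeAt_eq_univ hacc]
    trivial
  have h2 := hv.hasFDerivWithinAt.mapsTo_tangent_cone h1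
  refine Submodule.subset_span (tangentConeAt_mono ?_ (by simpa using h2))
  rintro _ ⟨s, hs, rfl⟩
  exact hγ s hs

theorem IsGeodesic.velocity_mem {N : Set (Amb d)} {γ γ' : ℝ → Amb d} (h : IsGeodesic N γ γ')
    {t : ℝ} (ht : t ∈ Icc (0 : ℝ) 1) : γ' t ∈ tangentSpaceAt N (γ t) :=
  velocity_mem_tangentSpaceAt (fun s hs => (h s hs).1) ht (h t ht).2.1

/-- Geodesics have constant speed. -/
theorem IsGeodesic.norm_velocity {N : Set (Amb d)} {γ γ' : ℝ → Amb d} (h : IsGeodesic N γ γ')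
    {t : ℝ} (ht : t ∈ Icc (0 : ℝ) 1) : ‖γ' t‖ = ‖γ' 0‖ := by
  have hd : ∀ s ∈ Icc (0 : ℝ) 1, HasDerivWithinAt (fun s => ‖γ' s‖ ^ 2) 0 (Icc 0 1) s := by
    intro s hs
    obtain ⟨-, -, a, ha, hda⟩ := h s hs
    have := hda.norm_sq
    rwa [Submodule.inner_right_of_mem_orthogonal (h.velocity_mem hs) ha, mul_zero] at this
  have := norm_sub_zero_le_of_deriv hd (C := 0) (by simp) ht
  have h2 : ‖γ' t‖ ^ 2 = ‖γ' 0‖ ^ 2 := by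
    rw [← sub_eq_zero, ← norm_le_zero_iff]
    exact this
  exact (pow_left_inj₀ (norm_nonneg _) (norm_nonneg _) two_ne_zero).1 h2

theorem IsGeodesic.norm_sub_le {N : Set (Amb d)} {γ γ' : ℝ → Amb d} (h : IsGeodesic N γ γ')
    {t : ℝ} (ht : t ∈ Icc (0 : ℝ) 1) : ‖γ t - γ 0‖ ≤ ‖γ' 0‖ :=
  norm_sub_zero_le_of_deriv (fun s hs => (h s hs).2.1) (fun _ hs => (h.norm_velocity hs).le) ht

namespace Parametrization

variable {N : Set (Amb d)} {x₀ : Amb d} (D : Parametrization m N x₀)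
  {u : EuclideanSpace ℝ (Fin m)} {z : Amb d}

/-- The differential of the parametrization. -/
def A (u : EuclideanSpace ℝ (Fin m)) : EuclideanSpace ℝ (Fin m) →L[ℝ] Amb d := fderiv ℝ D.ψ u

/-- The inverse metric tensor. -/
def gInv (u : EuclideanSpace ℝ (Fin m)) :
    EuclideanSpace ℝ (Fin m) →L[ℝ] EuclideanSpace ℝ (Fin m) :=
  Ring.inverse ((D.A u).adjoint ∘L D.A u)

/-- The Moore-Penrose inverse of the differential of the parametrization. -/
def L (u : EuclideanSpace ℝ (Fin m)) : Amb d →L[ℝ] EuclideanSpace ℝ (Fin m) :=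
  D.gInv u ∘L (D.A u).adjoint

/-- A smooth extension of `z ↦ (orthogonal projection onto T_z N)` to an open set. -/
def P (z : Amb d) : Amb d →L[ℝ] Amb d := D.A (D.θ z) ∘L D.L (D.θ z)

theorem contDiffAt_ψ (hu : u ∈ D.O) : ContDiffAt ℝ ∞ D.ψ u :=
  D.contDiffOn_ψ.contDiffAt (D.isOpen_O.mem_nhds hu)

theorem contDiffAt_θ (hz : z ∈ D.U) : ContDiffAt ℝ ∞ D.θ z :=
  D.contDiffOn_θ.contDiffAt (D.isOpen_U.mem_nhds hz)

theorem hasFDerivAt_ψ (hu : u ∈ D.O) : HasFDerivAt D.ψ (D.A u) u :=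
  ((D.contDiffAt_ψ hu).differentiableAt (by simp)).hasFDerivAt

theorem contDiffAt_A (hu : u ∈ D.O) : ContDiffAt ℝ ∞ D.A u :=
  (D.contDiffAt_ψ hu).fderiv_right (m := ∞) (by simp)

theorem fderiv_θ_A (hu : u ∈ D.O) (w : EuclideanSpace ℝ (Fin m)) :
    fderiv ℝ D.θ (D.ψ u) (D.A u w) = w := by
  have h1 : HasFDerivAt D.θ (fderiv ℝ D.θ (D.ψ u)) (D.ψ u) :=
    ((D.contDiffAt_θ (D.ψ_mem_U u hu)).differentiableAt (by simp)).hasFDerivAt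
  have h2 := h1.comp u (D.hasFDerivAt_ψ hu)
  have h3 : HasFDerivAt (D.θ ∘ D.ψ) (ContinuousLinearMap.id ℝ _) u :=
    (hasFDerivAt_id u).congr_of_eventuallyEq <| by
      filter_upwards [D.isOpen_O.mem_nhds hu] with w hw using D.θ_ψ w hw
  exact congrArg (fun T : EuclideanSpace ℝ (Fin m) →L[ℝ] EuclideanSpace ℝ (Fin m) => T w)
    (h2.unique h3)

/-- `ψ ∘ θ` is the identity on `N`, so its derivative, which factors through `A u`, fixes every
vector of the tangent cone. Conversely `ψ` maps an open set into `N`. -/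
theorem tangentSpaceAt_eq (hu : u ∈ D.O) :
    tangentSpaceAt N (D.ψ u) = LinearMap.range (D.A u).toLinearMap := by
  apply le_antisymm
  · refine Submodule.span_le.2 fun v hv => ?_
    have h1 : HasFDerivAt D.θ (fderiv ℝ D.θ (D.ψ u)) (D.ψ u) :=
      ((D.contDiffAt_θ (D.ψ_mem_U u hu)).differentiableAt (by simp)).hasFDerivAt
    have h0 : HasFDerivAt D.ψ (D.A u) (D.θ (D.ψ u)) := by
      rw [D.θ_ψ u hu]
      exact D.hasFDerivAt_ψ hu
    have h2 := (h0.comp (D.ψ u) h1).hasFDerivWithinAt (s := N)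
    have h3 : HasFDerivWithinAt (D.ψ ∘ D.θ) (ContinuousLinearMap.id ℝ _) N (D.ψ u) := by
      refine (hasFDerivWithinAt_id (D.ψ u) N).congr_of_eventuallyEq ?_
        (D.ψ_θ _ (D.ψ_mem_U u hu) (D.ψ_mem u hu))
      filter_upwards [self_mem_nhdsWithin,
        mem_nhdsWithin_of_mem_nhds (D.isOpen_U.mem_nhds (D.ψ_mem_U u hu))] with w hw hwU
      exact D.ψ_θ w hwU hw
    have h4 := h2.unique_on h3 hv
    exact ⟨_, h4⟩
  · rintro _ ⟨w, rfl⟩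
    have h1 := (D.hasFDerivAt_ψ hu).hasFDerivWithinAt (s := D.O)
    have h2 := h1.mapsTo_tangent_cone (show w ∈ _ by
      rw [tangentConeAt_of_mem_nhds (D.isOpen_O.mem_nhds hu)]
      trivial)
    refine Submodule.subset_span (tangentConeAt_mono ?_ h2)
    rintro _ ⟨s, hs, rfl⟩
    exact D.ψ_mem s hs

/-- `A u` is injective because the derivative of `θ` inverts it on the left; hence the Gram operator
is injective, and bijective by finite dimension. -/
theorem isUnit_gram (hu : u ∈ D.O) : IsUnit ((D.A u).adjoint ∘L D.A u) := by
  have hinj : LinearMap.ker ((D.A u).adjoint ∘L D.A u).toLinearMap = ⊥ := by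
    refine LinearMap.ker_eq_bot'.2 fun w hw => ?_
    have hw' : (D.A u).adjoint (D.A u w) = 0 := hw
    have h1 : inner ℝ (D.A u w) (D.A u w) = 0 := by
      rw [← ContinuousLinearMap.adjoint_inner_left, hw', inner_zero_left]
    rw [← D.fderiv_θ_A hu w, inner_self_eq_zero.1 h1, map_zero]
  rw [ContinuousLinearMap.isUnit_iff_bijective]
  have hi := LinearMap.ker_eq_bot.1 hinj
  exact ⟨hi, LinearMap.injective_iff_surjective.1 hi⟩

theorem L_A (hu : u ∈ D.O) (w : EuclideanSpace ℝ (Fin m)) : D.L u (D.A u w) = w :=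
  congrArg (fun T : EuclideanSpace ℝ (Fin m) →L[ℝ] EuclideanSpace ℝ (Fin m) => T w)
    (Ring.inverse_mul_cancel _ (D.isUnit_gram hu))

theorem adjoint_A_L (hu : u ∈ D.O) (v : Amb d) :
    (D.A u).adjoint (D.A u (D.L u v)) = (D.A u).adjoint v :=
  congrArg (fun T : EuclideanSpace ℝ (Fin m) →L[ℝ] EuclideanSpace ℝ (Fin m) =>
    T ((D.A u).adjoint v)) (Ring.mul_inverse_cancel _ (D.isUnit_gram hu))

/-- These are the normal equations: `A u ∘ L u` is the orthogonal projection onto the tangent space.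
-/
theorem sub_A_L_mem (hu : u ∈ D.O) (v : Amb d) :
    v - D.A u (D.L u v) ∈ (tangentSpaceAt N (D.ψ u))ᗮ := by
  rw [D.tangentSpaceAt_eq hu, Submodule.mem_orthogonal]
  rintro _ ⟨w, rfl⟩
  change inner ℝ (D.A u w) _ = 0
  rw [← ContinuousLinearMap.adjoint_inner_right, map_sub, D.adjoint_A_L hu, sub_self,
    inner_zero_right]

theorem L_eq_zero (hu : u ∈ D.O) {v : Amb d} (hv : v ∈ (tangentSpaceAt N (D.ψ u))ᗮ) :
    D.L u v = 0 := by
  have h : (D.A u).adjoint v = 0 := by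
    refine ext_inner_left ℝ fun w => ?_
    rw [ContinuousLinearMap.adjoint_inner_right, inner_zero_right]
    rw [D.tangentSpaceAt_eq hu, Submodule.mem_orthogonal] at hv
    exact hv _ ⟨w, rfl⟩
  change D.gInv u ((D.A u).adjoint v) = 0
  rw [h, map_zero]

theorem contDiffAt_L (hu : u ∈ D.O) : ContDiffAt ℝ ∞ D.L u := by
  have hadj : IsBoundedLinearMap ℝ
      (fun T : EuclideanSpace ℝ (Fin m) →L[ℝ] Amb d => T.adjoint) :=
    ⟨⟨fun x y => map_add _ x y, fun c x => by simp⟩, 1, one_pos, fun x => by simp⟩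
  have hA := D.contDiffAt_A hu
  have hAd : ContDiffAt ℝ ∞ (fun u => (D.A u).adjoint) u := hadj.contDiff.contDiffAt.comp u hA
  obtain ⟨w, hw⟩ := D.isUnit_gram hu
  have h1 : ContDiffAt ℝ ∞ Ring.inverse ((D.A u).adjoint ∘L D.A u) := by
    rw [← hw]
    exact contDiffAt_ringInverse ℝ w
  have h2 : ContDiffAt ℝ ∞ D.gInv u :=
    ContDiffAt.comp u (f := fun u => (D.A u).adjoint ∘L D.A u) h1 (hAd.clm_comp hA)
  exact h2.clm_comp hAd

theorem contDiffAt_P (hz : z ∈ D.U) : ContDiffAt ℝ ∞ D.P z := by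
  have hθ := D.contDiffAt_θ hz
  have hO := D.θ_mem z hz
  exact ((D.contDiffAt_A hO).comp z hθ).clm_comp ((D.contDiffAt_L hO).comp z hθ)

theorem P_of_mem (hz : z ∈ D.U) (hzN : z ∈ N) {v : Amb d} (hv : v ∈ tangentSpaceAt N z) :
    D.P z v = v := by
  rw [← D.ψ_θ z hz hzN, D.tangentSpaceAt_eq (D.θ_mem z hz)] at hv
  obtain ⟨w, rfl⟩ := hv
  exact congrArg _ (D.L_A (D.θ_mem z hz) w)

theorem P_of_mem_orthogonal (hz : z ∈ D.U) (hzN : z ∈ N) {v : Amb d}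
    (hv : v ∈ (tangentSpaceAt N z)ᗮ) : D.P z v = 0 := by
  rw [← D.ψ_θ z hz hzN] at hv
  change D.A (D.θ z) (D.L (D.θ z) v) = 0
  rw [D.L_eq_zero (D.θ_mem z hz) hv, map_zero]

/-- The geodesic equation in the ambient space. -/
theorem hasDerivWithinAt_velocity {γ γ' : ℝ → Amb d} (h : IsGeodesic N γ γ')
    (hU : ∀ t ∈ Icc (0 : ℝ) 1, γ t ∈ D.U) {t : ℝ} (ht : t ∈ Icc (0 : ℝ) 1) :
    HasDerivWithinAt γ' (fderiv ℝ D.P (γ t) (γ' t) (γ' t)) (Icc 0 1) t := by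
  obtain ⟨hN, hd, a, ha, hda⟩ := h t ht
  have hP : HasFDerivAt D.P (fderiv ℝ D.P (γ t)) (γ t) :=
    ((D.contDiffAt_P (hU t ht)).differentiableAt (by simp)).hasFDerivAt
  -- The product rule for `γ' = P(γ) γ'`; the term `P(γ) a` drops out because the acceleration `a`
  -- is normal.
  have h1 := (hP.comp_hasDerivWithinAt t hd).clm_apply hda
  rw [Function.comp_apply, D.P_of_mem_orthogonal (hU t ht) hN ha, add_zero] at h1
  exact h1.congr_of_mem (fun s hs => (D.P_of_mem (hU s hs) (h s hs).1 (h.velocity_mem hs)).symm) ht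

/-- The right-hand side of the geodesic equation in local coordinates. -/
def G (u : EuclideanSpace ℝ (Fin m)) : EuclideanSpace ℝ (Fin m) →L[ℝ]
    EuclideanSpace ℝ (Fin m) →L[ℝ] EuclideanSpace ℝ (Fin m) :=
  -((ContinuousLinearMap.compL ℝ _ _ _ (D.L u)) ∘L fderiv ℝ D.A u)

theorem contDiffAt_G (hu : u ∈ D.O) : ContDiffAt ℝ ∞ D.G u := by
  have h1 : ContDiffAt ℝ ∞ (fderiv ℝ D.A) u := (D.contDiffAt_A hu).fderiv_right (m := ∞) (by simp)
  have h2 : ContDiffAt ℝ ∞ (fun u => ContinuousLinearMap.compL ℝ (EuclideanSpace ℝ (Fin m))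
      (Amb d) (EuclideanSpace ℝ (Fin m)) (D.L u)) u :=
    contDiffAt_const.clm_apply (D.contDiffAt_L hu)
  exact (h2.clm_comp h1).neg

/-- The acceleration of `ψ ∘ w` is `a + A w''` with `a = DA(w', w')`. The choice `w'' = -L a` makes
it `a - A L a`, the normal component of `a`. -/
theorem isGeodesic_of_solvesQuadratic {S : Set (EuclideanSpace ℝ (Fin m))} (hS : S ⊆ D.O) {η : ℝ}
    {w w' : ℝ → EuclideanSpace ℝ (Fin m)} (h : SolvesQuadratic D.G S η w w') :
    IsGeodesic N (fun t => D.ψ (w t)) (fun t => D.A (w t) (w' t)) := by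
  intro t ht
  obtain ⟨h1, h2, h3, -⟩ := h t ht
  have hO := hS h3
  refine ⟨D.ψ_mem _ hO, (D.hasFDerivAt_ψ hO).comp_hasDerivWithinAt t h1, _, ?_,
    ((((D.contDiffAt_A hO).differentiableAt (by simp)).hasFDerivAt.comp_hasDerivWithinAt t
      h1).clm_apply h2)⟩
  have := D.sub_A_L_mem hO (fderiv ℝ D.A (w t) (w' t) (w' t))
  rw [sub_eq_add_neg, ← map_neg] at this
  exact this

end Parametrization

end Parametrization

end ManifoldLearning

namespace ManifoldLearning

/-! ### Normal coordinates, Taylor expansion and volume near one point. -/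

section LocalGeometry

variable {d m : ℕ} {N : Set (Amb d)} {x₀ : Amb d}

/-- Near a point of `N`, short geodesics solve one quadratic second order equation in `ℝ^d`. -/
theorem exists_isGeodesic_solvesQuadratic (hN : IsSubmanifold m N) (hx₀ : x₀ ∈ N) :
    ∃ B : Amb d → Amb d →L[ℝ] Amb d →L[ℝ] Amb d, ContDiffAt ℝ 1 B x₀ ∧
      ∃ ρ > 0, ∀ γ γ' : ℝ → Amb d, IsGeodesic N γ γ' → ∀ s, ‖γ 0 - x₀‖ + ‖γ' 0‖ < s → s ≤ ρ →
        SolvesQuadratic B (Metric.ball x₀ s) ‖γ' 0‖ γ γ' := by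
  obtain ⟨D⟩ := hN.exists_parametrization hx₀
  have hB : ContDiffAt ℝ 1 (fderiv ℝ D.P) x₀ :=
    ((D.contDiffAt_P D.mem_U).fderiv_right (m := ∞) (by simp)).of_le (by exact_mod_cast le_top)
  obtain ⟨ρ, hρ, hρU⟩ := Metric.isOpen_iff.1 D.isOpen_U x₀ D.mem_U
  refine ⟨fderiv ℝ D.P, hB, ρ, hρ, fun γ γ' h s hs hsρ => ?_⟩
  have hball : ∀ t ∈ Icc (0 : ℝ) 1, γ t ∈ Metric.ball x₀ s := by
    intro t ht
    rw [mem_ball_iff_norm]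
    calc ‖γ t - x₀‖ = ‖(γ 0 - x₀) + (γ t - γ 0)‖ := by congr 1; abel
      _ ≤ ‖γ 0 - x₀‖ + ‖γ' 0‖ := (norm_add_le _ _).trans (by gcongr; exact h.norm_sub_le ht)
      _ < s := hs
  exact fun t ht => ⟨(h t ht).2.1, D.hasDerivWithinAt_velocity h
    (fun s hs => hρU (Metric.ball_subset_ball hsρ (hball s hs))) ht, hball t ht,
    (h.norm_velocity ht).le⟩

theorem SolvesQuadratic.mono_speed {V : Type*} [NormedAddCommGroup V] [NormedSpace ℝ V]
    {B : V → V →L[ℝ] V →L[ℝ] V} {S : Set V}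
    {ε ε' : ℝ} {γ γ' : ℝ → V} (h : SolvesQuadratic B S ε γ γ') (hε : ε ≤ ε') :
    SolvesQuadratic B S ε' γ γ' :=
  fun t ht => ⟨(h t ht).1, (h t ht).2.1, (h t ht).2.2.1, (h t ht).2.2.2.trans hε⟩

/-- The initial velocity of a short geodesic is a Lipschitz function of its end points. -/
theorem exists_expFiber_lipschitz (hN : IsSubmanifold m N) (hx₀ : x₀ ∈ N) :
    ∃ r > 0, ∀ y₁ ∈ Metric.ball x₀ r, ∀ y₂ ∈ Metric.ball x₀ r, ∀ x₁ x₂,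
      ∀ v₁ ∈ expFiber N y₁ x₁, ∀ v₂ ∈ expFiber N y₂ x₂, ‖v₁‖ ≤ r → ‖v₂‖ ≤ r →
        ‖v₁ - v₂‖ ≤ 2 * (‖y₁ - y₂‖ + ‖x₁ - x₂‖) := by
  obtain ⟨B, hB, ρ, hρ, hgeo⟩ := exists_isGeodesic_solvesQuadratic hN hx₀
  obtain ⟨σ, hσ, K, hK0, hK, hL⟩ := exists_ball_lipschitz_bound hB
  set s := min ρ σ with hs
  have hs0 : 0 < s := by positivity
  -- `s / 2` confines the geodesics to the ball of radius `s`; `1 / (24 * K)` gives `κ = 1/8`. Then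
  -- `(3/4)‖v₁ - v₂‖ ≤ (5/4)‖y₁ - y₂‖ + ‖x₁ - x₂‖`, which implies the bound with constant `2`.
  set r := min (s / 2) (min 1 (1 / (24 * K))) with hr
  have hr0 : 0 < r := by positivity
  have hrs : r ≤ s / 2 := min_le_left _ _
  have hr1 : r ≤ 1 := (min_le_right _ _).trans (min_le_left _ _)
  have hrK : r ≤ 1 / (24 * K) := (min_le_right _ _).trans (min_le_right _ _)
  rw [le_div_iff₀ (by positivity)] at hrK
  have hsub : Metric.ball x₀ s ⊆ Metric.ball x₀ σ := Metric.ball_subset_ball (min_le_right _ _)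
  refine ⟨r, hr0, ?_⟩
  rintro y₁ hy₁ y₂ hy₂ x₁ x₂ v₁ ⟨γ₁, γ₁', h₁, rfl, rfl, rfl⟩ v₂ ⟨γ₂, γ₂', h₂, rfl, rfl, rfl⟩ b₁ b₂
  rw [mem_ball_iff_norm] at hy₁ hy₂
  have s₁ := (hgeo γ₁ γ₁' h₁ s (by linarith) (min_le_left _ _)).mono_speed b₁
  have s₂ := (hgeo γ₂ γ₂' h₂ s (by linarith) (min_le_left _ _)).mono_speed b₂
  have key := SolvesQuadratic.norm_velocity_sub_le (κ := 1 / 8) (fun z hz => hK z (hsub hz))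
    (fun z₁ h₁ z₂ h₂ => hL z₁ (hsub h₁) z₂ (hsub h₂)) (by nlinarith) (by norm_num) s₁ s₂
  have t1 := norm_sub_norm_le (γ₁' 0 - γ₂' 0) ((γ₁ 1 - γ₂ 1) - (γ₁ 0 - γ₂ 0))
  rw [norm_sub_rev (γ₁' 0 - γ₂' 0)] at t1
  have t2 := norm_sub_le (γ₁ 1 - γ₂ 1) (γ₁ 0 - γ₂ 0)
  linarith [norm_nonneg (γ₁ 1 - γ₂ 1), norm_nonneg (γ₁ 0 - γ₂ 0)]

/-- Any two points of `N` near a given one are joined by a short geodesic. -/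
theorem exists_mem_expFiber (hN : IsSubmanifold m N) (hx₀ : x₀ ∈ N) :
    ∃ r > 0, ∃ C > 0, ∀ y ∈ N ∩ Metric.ball x₀ r, ∀ x ∈ N ∩ Metric.ball x₀ r,
      ∃ v ∈ expFiber N y x, ‖v‖ ≤ C * ‖x - y‖ := by
  obtain ⟨D⟩ := hN.exists_parametrization hx₀
  have hO := D.θ_mem x₀ D.mem_U
  obtain ⟨η, hη, hηO⟩ := Metric.isOpen_iff.1 D.isOpen_O _ hO
  obtain ⟨ρ, hρ, hjoin⟩ := exists_solvesQuadratic_joining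
    ((D.contDiffAt_G hO).of_le (by exact_mod_cast le_top)) hη
  obtain ⟨σ, hσ, K, hK0, -, hK⟩ := exists_ball_lipschitz_bound
    ((D.contDiffAt_θ D.mem_U).of_le (m := 1) (by exact_mod_cast le_top))
  obtain ⟨τ, hτ, C, hC0, hC, -⟩ := exists_ball_lipschitz_bound
    ((D.contDiffAt_A hO).of_le (m := 1) (by exact_mod_cast le_top))
  obtain ⟨δ, hδ, hδU⟩ := Metric.isOpen_iff.1 D.isOpen_U x₀ D.mem_U
  have hc : ∀ᶠ z in 𝓝 x₀, D.θ z ∈ Metric.ball (D.θ x₀) (min ρ τ) :=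
    (D.contDiffAt_θ D.mem_U).continuousAt.eventually_mem (Metric.ball_mem_nhds _ (by positivity))
  obtain ⟨ε, hε, hεc⟩ := Metric.mem_nhds_iff.1 hc
  -- `K` is the Lipschitz constant of `θ`, `2` comes from the joining solution, and `C` bounds the
  -- differential of `ψ`.
  refine ⟨min ε (min σ δ), by positivity, C * (2 * K), by positivity, ?_⟩
  rintro y ⟨hyN, hy⟩ x ⟨hxN, hx⟩
  have sub1 : Metric.ball x₀ (min ε (min σ δ)) ⊆ Metric.ball x₀ ε :=
    Metric.ball_subset_ball (min_le_left _ _)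
  have sub2 : Metric.ball x₀ (min ε (min σ δ)) ⊆ Metric.ball x₀ σ :=
    Metric.ball_subset_ball ((min_le_right _ _).trans (min_le_left _ _))
  have sub3 : Metric.ball x₀ (min ε (min σ δ)) ⊆ Metric.ball x₀ δ :=
    Metric.ball_subset_ball ((min_le_right _ _).trans (min_le_right _ _))
  have hθy : D.θ y ∈ Metric.ball (D.θ x₀) (min ρ τ) := hεc (sub1 hy)
  have hθx : D.θ x ∈ Metric.ball (D.θ x₀) (min ρ τ) := hεc (sub1 hx)
  obtain ⟨u, u', hu, hu0, hu1, hu'⟩ := hjoin (D.θ y)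
    (Metric.ball_subset_ball (min_le_left _ _) hθy) (D.θ x)
    (Metric.ball_subset_ball (min_le_left _ _) hθx)
  refine ⟨D.A (u 0) (u' 0), ⟨_, _, D.isGeodesic_of_solvesQuadratic hηO hu, ?_, rfl, ?_⟩, ?_⟩
  · simp only [hu0]
    exact D.ψ_θ y (hδU (sub3 hy)) hyN
  · simp only [hu1]
    exact D.ψ_θ x (hδU (sub3 hx)) hxN
  · rw [hu0]
    calc ‖D.A (D.θ y) (u' 0)‖ ≤ C * (2 * (K * ‖x - y‖)) := by
          refine ((D.A (D.θ y)).le_opNorm _).trans ?_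
          gcongr
          · exact hC _ (Metric.ball_subset_ball (min_le_right _ _) hθy)
          · refine hu'.trans ?_
            gcongr
            exact hK _ (sub2 hx) _ (sub2 hy)
      _ = C * (2 * K) * ‖x - y‖ := by ring

/-- Uniqueness among vectors no longer than `v` already makes `v` a minimizer, and the arbitrary
choice in `normalCoord` must return it. -/
theorem normalCoord_eq {y x v : Amb d} (hv : v ∈ expFiber N y x)
    (huniq : ∀ w ∈ expFiber N y x, ‖w‖ ≤ ‖v‖ → w = v) : normalCoord N y x = v := by
  have hex : ∃ v ∈ expFiber N y x, ∀ w ∈ expFiber N y x, ‖v‖ ≤ ‖w‖ := by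
    refine ⟨v, hv, fun w hw => ?_⟩
    by_contra hlt
    rw [huniq w hw (not_le.1 hlt).le] at hlt
    exact hlt le_rfl
  rw [normalCoord, dif_pos hex]
  exact huniq _ hex.choose_spec.1 (hex.choose_spec.2 v hv)

/-- Near the diagonal the normal coordinate vector is a shortest initial velocity, comparable to
the distance and Lipschitz. -/
theorem exists_ball_normalCoord (hN : IsSubmanifold m N) (hx₀ : x₀ ∈ N) :
    ∃ r > 0, ∃ C > 0,
      (∀ y ∈ N ∩ Metric.ball x₀ r, ∀ x ∈ N ∩ Metric.ball x₀ r,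
        normalCoord N y x ∈ expFiber N y x ∧ ‖normalCoord N y x‖ ≤ C * ‖x - y‖) ∧
      ∀ y₁ ∈ N ∩ Metric.ball x₀ r, ∀ x₁ ∈ N ∩ Metric.ball x₀ r,
        ∀ y₂ ∈ N ∩ Metric.ball x₀ r, ∀ x₂ ∈ N ∩ Metric.ball x₀ r,
          ‖normalCoord N y₁ x₁ - normalCoord N y₂ x₂‖ ≤ 2 * (‖y₁ - y₂‖ + ‖x₁ - x₂‖) := by
  obtain ⟨r, hr, hlip⟩ := exists_expFiber_lipschitz hN hx₀
  obtain ⟨s, hs, C, hC, hex⟩ := exists_mem_expFiber hN hx₀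
  -- With `t ≤ r / (2 * C)` the joining geodesic has velocity at most `r`, the range of `hlip`;
  -- there `hlip` with equal end points gives uniqueness.
  set t := min (min r s) (r / (2 * C)) with ht
  have ht0 : 0 < t := by positivity
  have htr : t ≤ r := (min_le_left _ _).trans (min_le_left _ _)
  have hts : t ≤ s := (min_le_left _ _).trans (min_le_right _ _)
  have htC : t * (2 * C) ≤ r := (le_div_iff₀ (by positivity)).1 (min_le_right _ _)
  have main : ∀ y ∈ N ∩ Metric.ball x₀ t, ∀ x ∈ N ∩ Metric.ball x₀ t,
      normalCoord N y x ∈ expFiber N y x ∧ ‖normalCoord N y x‖ ≤ C * ‖x - y‖ ∧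
        ‖normalCoord N y x‖ ≤ r := by
    rintro y ⟨hyN, hy⟩ x ⟨hxN, hx⟩
    obtain ⟨v, hv, hvC⟩ := hex y ⟨hyN, Metric.ball_subset_ball hts hy⟩ x
      ⟨hxN, Metric.ball_subset_ball hts hx⟩
    have hxy : ‖x - y‖ ≤ 2 * t := by
      rw [← dist_eq_norm]
      have := dist_triangle_right x y x₀
      have h1 := Metric.mem_ball.1 hx
      have h2 := Metric.mem_ball.1 hy
      linarith
    have hvr : ‖v‖ ≤ r := by
      refine hvC.trans (le_trans ?_ htC)
      nlinarith
    have heq : normalCoord N y x = v := by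
      refine normalCoord_eq hv fun w hw hwv => ?_
      have hyr := Metric.ball_subset_ball htr hy
      have := hlip y hyr y hyr x x w hw v hv (hwv.trans hvr) hvr
      simpa [sub_eq_zero] using this
    rw [heq]
    exact ⟨hv, hvC, hvr⟩
  refine ⟨t, ht0, C, hC, fun y hy x hx => ⟨(main y hy x hx).1, (main y hy x hx).2.1⟩,
    fun y₁ hy₁ x₁ hx₁ y₂ hy₂ x₂ hx₂ => ?_⟩
  obtain ⟨m₁, -, b₁⟩ := main y₁ hy₁ x₁ hx₁
  obtain ⟨m₂, -, b₂⟩ := main y₂ hy₂ x₂ hx₂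
  exact hlip y₁ (Metric.ball_subset_ball htr hy₁.2) y₂ (Metric.ball_subset_ball htr hy₂.2) x₁ x₂
    _ m₁ _ m₂ b₁ b₂

/-- Second order Taylor expansion along geodesics, uniform in the starting point. -/
theorem exists_taylor_expFiber (hN : IsSubmanifold m N) (hx₀ : x₀ ∈ N) {F : Amb d → ℝ}
    {U : Set (Amb d)} (hU : IsOpen U) (hxU : x₀ ∈ U) (hF : ContDiffOn ℝ ∞ F U) :
    ∃ r > 0, ∃ C > 0, ∀ y ∈ Metric.ball x₀ r, ∃ (l : Amb d →L[ℝ] ℝ)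
      (q : Amb d →L[ℝ] Amb d →L[ℝ] ℝ), ∀ x, ∀ v ∈ expFiber N y x, ‖v‖ ≤ r →
        |F x - (F y + l v + q v v)| ≤ C * ‖v‖ ^ 3 := by
  obtain ⟨B, hB, ρ, hρ, hgeo⟩ := exists_isGeodesic_solvesQuadratic hN hx₀
  obtain ⟨σ, hσ, K, hK0, hK, -⟩ := exists_ball_lipschitz_bound hB
  have hF1 : ∀ z ∈ U, ContDiffAt ℝ ∞ F z := fun z hz => hF.contDiffAt (hU.mem_nhds hz)
  have hF2 : ∀ z ∈ U, ContDiffAt ℝ ∞ (fderiv ℝ F) z := fun z hz =>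
    (hF1 z hz).fderiv_right (m := ∞) (by simp)
  have hF3 : ∀ z ∈ U, ContDiffAt ℝ ∞ (fderiv ℝ (fderiv ℝ F)) z := fun z hz =>
    (hF2 z hz).fderiv_right (m := ∞) (by simp)
  -- Along a geodesic `γ'' = B(γ)(γ', γ')`, so `Q(γ)(γ', γ')` is the second derivative of `F ∘ γ`.
  set Q : Amb d → Amb d →L[ℝ] Amb d →L[ℝ] ℝ := fun z =>
    fderiv ℝ (fderiv ℝ F) z + (ContinuousLinearMap.compL ℝ _ _ _ (fderiv ℝ F z)) ∘L B z with hQ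
  have hQc : ContDiffAt ℝ 1 Q x₀ := by
    have h1 : ContDiffAt ℝ 1 (fun z => ContinuousLinearMap.compL ℝ (Amb d) (Amb d) ℝ
        (fderiv ℝ F z)) x₀ :=
      contDiffAt_const.clm_apply ((hF2 x₀ hxU).of_le (by exact_mod_cast le_top))
    exact ((hF3 x₀ hxU).of_le (by exact_mod_cast le_top)).add (h1.clm_comp hB)
  have hQa : ∀ z v, Q z v v = fderiv ℝ (fderiv ℝ F) z v v + fderiv ℝ F z (B z v v) :=
    fun z v => rfl
  obtain ⟨τ, hτ, K', hK'0, hK', hL'⟩ := exists_ball_lipschitz_bound hQc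
  obtain ⟨δ, hδ, hδU⟩ := Metric.isOpen_iff.1 hU x₀ hxU
  set s := min (min ρ σ) (min τ δ) with hs
  have hs0 : 0 < s := by positivity
  have hsσ : Metric.ball x₀ s ⊆ Metric.ball x₀ σ :=
    Metric.ball_subset_ball ((min_le_left _ _).trans (min_le_right _ _))
  have hsτ : Metric.ball x₀ s ⊆ Metric.ball x₀ τ :=
    Metric.ball_subset_ball ((min_le_right _ _).trans (min_le_left _ _))
  have hsU : Metric.ball x₀ s ⊆ U :=
    (Metric.ball_subset_ball ((min_le_right _ _).trans (min_le_right _ _))).trans hδU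
  refine ⟨s / 2, by positivity, K' + 2 * K' * K, by positivity, fun y hy =>
    ⟨fderiv ℝ F y, (1 / 2 : ℝ) • Q y, ?_⟩⟩
  rintro x v ⟨γ, γ', h, rfl, rfl, rfl⟩ hv
  rw [mem_ball_iff_norm] at hy
  have sol := hgeo γ γ' h s (by linarith) ((min_le_left _ _).trans (min_le_left _ _))
  have z0 : (0 : ℝ) ∈ Icc (0 : ℝ) 1 := by simp
  have d1 : ∀ t ∈ Icc (0 : ℝ) 1, HasDerivWithinAt (fun t => F (γ t)) (fderiv ℝ F (γ t) (γ' t))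
      (Icc 0 1) t := fun t ht =>
    ((hF1 _ (hsU (sol t ht).2.2.1)).differentiableAt (by simp)).hasFDerivAt.comp_hasDerivWithinAt
      t (sol t ht).1
  have d2 : ∀ t ∈ Icc (0 : ℝ) 1, HasDerivWithinAt (fun t => fderiv ℝ F (γ t) (γ' t))
      (Q (γ t) (γ' t) (γ' t)) (Icc 0 1) t := fun t ht =>
    (((hF2 _ (hsU (sol t ht).2.2.1)).differentiableAt
      (by simp)).hasFDerivAt.comp_hasDerivWithinAt t (sol t ht).1).clm_apply (sol t ht).2.1
  have hacc : ∀ t ∈ Icc (0 : ℝ) 1, ‖B (γ t) (γ' t) (γ' t)‖ ≤ K * ‖γ' 0‖ ^ 2 := by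
    intro t ht
    refine ((B (γ t)).le_opNorm₂ _ _).trans ?_
    rw [h.norm_velocity ht, mul_assoc, ← sq]
    gcongr
    exact hK _ (hsσ (sol t ht).2.2.1)
  -- The third order arises here: the point moves by at most `‖γ' 0‖` and the velocity changes by at
  -- most `K * ‖γ' 0‖ ^ 2`, inside a quadratic form in the velocity.
  have hQt : ∀ t ∈ Icc (0 : ℝ) 1, |Q (γ t) (γ' t) (γ' t) - Q (γ 0) (γ' 0) (γ' 0)| ≤
      (K' + 2 * K' * K) * ‖γ' 0‖ ^ 3 := by
    intro t ht
    have m₁ := hsτ (sol t ht).2.2.1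
    have m₀ := hsτ (sol 0 z0).2.2.1
    refine (norm_quadratic_sub_le _ _ (hK' _ m₀) (hL' _ m₁ _ m₀) _ _).trans ?_
    rw [h.norm_velocity ht]
    have e1 : ‖γ t - γ 0‖ ≤ ‖γ' 0‖ := h.norm_sub_le ht
    have e2 : ‖γ' t - γ' 0‖ ≤ K * ‖γ' 0‖ ^ 2 :=
      norm_sub_zero_le_of_deriv (fun s hs => (sol s hs).2.1) hacc ht
    calc K' * ‖γ t - γ 0‖ * ‖γ' 0‖ ^ 2 + K' * (‖γ' 0‖ + ‖γ' 0‖) * ‖γ' t - γ' 0‖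
        ≤ K' * ‖γ' 0‖ * ‖γ' 0‖ ^ 2 + K' * (‖γ' 0‖ + ‖γ' 0‖) * (K * ‖γ' 0‖ ^ 2) := by gcongr
      _ = (K' + 2 * K' * K) * ‖γ' 0‖ ^ 3 := by ring
  refine le_of_eq_of_le ?_ (abs_taylor_two_le d1 d2 hQt)
  congr 2
  simp only [smul_apply, smul_eq_mul]
  ring

/-- Affine plus quadratic functions are polynomials of degree at most two. -/
theorem exists_mvPolynomial_eval_eq (c : ℝ) (l : Amb d →L[ℝ] ℝ) (q : Amb d →L[ℝ] Amb d →L[ℝ] ℝ) :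
    ∃ p ∈ MvPolynomial.restrictTotalDegree (Fin d) ℝ 2,
      ∀ v : Amb d, MvPolynomial.eval v p = c + l v + q v v := by
  let e : Fin d → Amb d := fun i => EuclideanSpace.single i 1
  have hv : ∀ v : Amb d, v = ∑ i, v i • e i := fun v => by
    ext j
    simp [e, Finset.sum_apply, Pi.single_apply]
  refine ⟨MvPolynomial.C c + ∑ i, MvPolynomial.C (l (e i)) * MvPolynomial.X i +
    ∑ i, ∑ j, MvPolynomial.C (q (e i) (e j)) * (MvPolynomial.X i * MvPolynomial.X j), ?_, ?_⟩
  · refine Submodule.add_mem _ (Submodule.add_mem _ ?_ (Submodule.sum_mem _ fun i _ => ?_))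
      (Submodule.sum_mem _ fun i _ => Submodule.sum_mem _ fun j _ => ?_)
    · rw [MvPolynomial.mem_restrictTotalDegree]
      simp
    · rw [MvPolynomial.mem_restrictTotalDegree]
      refine (MvPolynomial.totalDegree_mul _ _).trans ?_
      simp
    · rw [MvPolynomial.mem_restrictTotalDegree]
      refine (MvPolynomial.totalDegree_mul _ _).trans ?_
      rw [MvPolynomial.totalDegree_C, zero_add]
      refine (MvPolynomial.totalDegree_mul _ _).trans ?_
      simp
  · intro v
    conv_rhs => rw [hv v]
    simp only [map_add, map_sum, MvPolynomial.eval_C, map_mul, MvPolynomial.eval_X, map_smul,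
      sum_apply, smul_apply, smul_eq_mul, Finset.mul_sum]
    congr 1
    · congr 1
      exact Finset.sum_congr rfl fun i _ => mul_comm _ _
    · rw [Finset.sum_comm]
      refine Finset.sum_congr rfl fun i _ => Finset.sum_congr rfl fun j _ => ?_
      ring

theorem volBall_pos (m : ℕ) {h : ℝ} (hh : 0 < h) : 0 < volBall m h :=
  ENNReal.toReal_pos (Metric.measure_ball_pos _ _ hh).ne' measure_ball_lt_top.ne

/-- Euclidean balls centred on `N` have volume `O(h^m)`, locally uniformly in the centre. -/
theorem exists_measure_inter_ball_le (hN : IsSubmanifold m N) (hx₀ : x₀ ∈ N) :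
    ∃ r > 0, ∃ C > 0, ∀ y ∈ N ∩ Metric.ball x₀ r, ∀ h, 0 < h → h < r →
      (μHE[m] : Measure (Amb d)) (N ∩ Metric.ball y h) ≤ ENNReal.ofReal (C * volBall m h) := by
  obtain ⟨D⟩ := hN.exists_parametrization hx₀
  have hO := D.θ_mem x₀ D.mem_U
  obtain ⟨σ, hσ, K, hK0, -, hK⟩ := exists_ball_lipschitz_bound
    ((D.contDiffAt_θ D.mem_U).of_le (m := 1) (by exact_mod_cast le_top))
  obtain ⟨τ, hτ, C, hC0, -, hC⟩ := exists_ball_lipschitz_bound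
    ((D.contDiffAt_ψ hO).of_le (m := 1) (by exact_mod_cast le_top))
  obtain ⟨δ, hδ, hδU⟩ := Metric.isOpen_iff.1 D.isOpen_U x₀ D.mem_U
  set r := min (min σ δ / 2) (τ / (2 * K)) with hr
  have hr0 : 0 < r := by positivity
  have hrσ : 2 * r ≤ σ := by
    have := (min_le_left (min σ δ / 2) (τ / (2 * K))).trans
      (div_le_div_of_nonneg_right (min_le_left σ δ) two_pos.le)
    linarith
  have hrδ : 2 * r ≤ δ := by
    have := (min_le_left (min σ δ / 2) (τ / (2 * K))).trans
      (div_le_div_of_nonneg_right (min_le_right σ δ) two_pos.le)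
    linarith
  have hrK : r * (2 * K) ≤ τ := (le_div_iff₀ (by positivity)).1 (min_le_right _ _)
  refine ⟨r, hr0, C ^ m * K ^ m, by positivity, ?_⟩
  rintro y ⟨hyN, hy⟩ h hh hhr
  have hyσ : y ∈ Metric.ball x₀ σ := Metric.ball_subset_ball (by linarith) hy
  have hball : Metric.ball (D.θ y) (K * h) ⊆ Metric.ball (D.θ x₀) τ := by
    refine Metric.ball_subset_ball' ?_
    have h1 : dist (D.θ y) (D.θ x₀) ≤ K * r := by
      rw [dist_eq_norm]
      refine (hK y hyσ x₀ (Metric.mem_ball_self hσ)).trans ?_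
      gcongr
      rw [← dist_eq_norm]
      exact (Metric.mem_ball.1 hy).le
    nlinarith
  -- A `C`-Lipschitz image of an `m`-ball of radius `K * h`, whence the constant `C ^ m * K ^ m`.
  have hsub : N ∩ Metric.ball y h ⊆ D.ψ '' Metric.ball (D.θ y) (K * h) := by
    rintro z ⟨hzN, hz⟩
    have hz2 : z ∈ Metric.ball x₀ (2 * r) := by
      rw [Metric.mem_ball] at *
      linarith [dist_triangle z y x₀]
    refine ⟨D.θ z, ?_, D.ψ_θ z (hδU (Metric.ball_subset_ball hrδ hz2)) hzN⟩
    rw [mem_ball_iff_norm] at hz ⊢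
    exact (hK z (Metric.ball_subset_ball hrσ hz2) y hyσ).trans_lt (by gcongr)
  have hlip : LipschitzOnWith C.toNNReal D.ψ (Metric.ball (D.θ y) (K * h)) := by
    refine LipschitzOnWith.of_dist_le_mul fun a ha b hb => ?_
    rw [dist_eq_norm, dist_eq_norm, Real.coe_toNNReal _ hC0.le]
    exact hC a (hball ha) b (hball hb)
  have hH := hlip.hausdorffMeasure_image_le (d := m) (Nat.cast_nonneg m)
  have hvol : (μHE[m] : Measure (Amb d)) (D.ψ '' Metric.ball (D.θ y) (K * h)) ≤
      ENNReal.ofReal (C ^ m) * volume (Metric.ball (D.θ y) (K * h)) := by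
    -- Both sides carry the same normalizing factor, so the Lipschitz bound for `μH[m]` transfers to
    -- `μHE[m]`.
    rw [← EuclideanSpace.euclideanHausdorffMeasure_eq_volume, Measure.euclideanHausdorffMeasure_def,
      Measure.euclideanHausdorffMeasure_def, Measure.smul_apply, Measure.smul_apply,
      ENNReal.smul_def, ENNReal.smul_def, smul_eq_mul, smul_eq_mul, mul_left_comm]
    gcongr
    refine hH.trans_eq ?_
    rw [ENNReal.rpow_natCast, ENNReal.ofReal_pow hC0.le]
    rfl
  refine (measure_mono hsub).trans (hvol.trans_eq ?_)
  rw [Measure.addHaar_ball_mul_of_pos _ _ hK0, finrank_euclideanSpace_fin, ← mul_assoc,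
    ← ENNReal.ofReal_mul (by positivity), volBall,
    ENNReal.ofReal_mul (p := C ^ m * K ^ m) (by positivity),
    ENNReal.ofReal_toReal measure_ball_lt_top.ne]

end LocalGeometry

end ManifoldLearning

namespace ManifoldLearning

/-! ### Uniform constants over the compact set `M`. -/

section Compactness

variable {d m : ℕ} {M N : Set (Amb d)}

/-- On a compact set, a local property with constants holds with uniform constants. -/
theorem exists_uniform_constants (hM : IsCompact M) {p : ℝ → ℝ → Amb d → Prop}
    (hp : ∀ r r' C C' y, r' ≤ r → C ≤ C' → p r C y → p r' C' y)
    (h : ∀ x ∈ M, ∃ r > 0, ∃ C > 0, ∀ y ∈ M ∩ Metric.ball x r, p r C y) :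
    ∃ r > 0, ∃ C > 0, ∀ y ∈ M, p r C y := by
  suffices ∃ r > 0, ∃ C > 0, ∀ y ∈ M ∩ M, p r C y by simpa using this
  refine hM.induction_on (p := fun s => ∃ r > 0, ∃ C > 0, ∀ y ∈ M ∩ s, p r C y)
    ⟨1, one_pos, 1, one_pos, by simp⟩ ?_ ?_ ?_
  · rintro s t hst ⟨r, hr, C, hC, hp⟩
    exact ⟨r, hr, C, hC, fun y hy => hp y ⟨hy.1, hst hy.2⟩⟩
  · rintro s t ⟨r, hr, C, hC, h₁⟩ ⟨r', hr', C', hC', h₂⟩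
    refine ⟨min r r', by positivity, max C C', by positivity, ?_⟩
    rintro y ⟨hyM, hy | hy⟩
    · exact hp _ _ _ _ y (min_le_left _ _) (le_max_left _ _) (h₁ y ⟨hyM, hy⟩)
    · exact hp _ _ _ _ y (min_le_right _ _) (le_max_right _ _) (h₂ y ⟨hyM, hy⟩)
  · intro x hx
    obtain ⟨r, hr, C, hC, hy⟩ := h x hx
    exact ⟨Metric.ball x r, mem_nhdsWithin_of_mem_nhds (Metric.ball_mem_nhds x hr), r, hr, C, hC,
      hy⟩

/-- The bound is inherited from `N` by monotonicity, so balls that meet the boundary of `M` are no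
exception. -/
theorem vol_ball_le (hN : IsSubmanifold m N) (hMc : IsCompact M) (hMN : M ⊆ N) :
    ∃ r > 0, ∃ C > 0, ∀ y ∈ M, ∀ h, 0 < h → h < r →
      vol m M (Metric.ball y h) ≤ ENNReal.ofReal (C * volBall m h) := by
  refine exists_uniform_constants hMc (fun r r' C C' y hr hC hp h hh hhr =>
    (hp h hh (hhr.trans_le hr)).trans (ENNReal.ofReal_le_ofReal ?_)) fun x hx => ?_
  · exact mul_le_mul_of_nonneg_right hC (volBall_pos m hh).le
  · obtain ⟨r, hr, C, hC, hb⟩ := exists_measure_inter_ball_le hN (hMN hx)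
    refine ⟨r, hr, C, hC, fun y hy h hh hhr => ?_⟩
    rw [vol, Measure.restrict_apply measurableSet_ball]
    refine (measure_mono ?_).trans (hb y ⟨hMN hy.1, hy.2⟩ h hh hhr)
    exact fun z hz => ⟨hMN hz.2, hz.1⟩

theorem isFiniteMeasure_vol (hN : IsSubmanifold m N) (hMc : IsCompact M) (hMN : M ⊆ N) :
    IsFiniteMeasure (vol m M) := by
  refine ⟨?_⟩
  rw [vol, Measure.restrict_apply_univ]
  refine hMc.measure_lt_top_of_nhdsWithin fun x hx => ?_
  obtain ⟨r, hr, C, hC, hb⟩ := exists_measure_inter_ball_le hN (hMN hx)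
  refine ⟨M ∩ Metric.ball x (r / 2), inter_mem_nhdsWithin _ (Metric.ball_mem_nhds _ (by positivity)),
    ?_⟩
  refine (measure_mono (inter_subset_inter_left _ hMN)).trans_lt ((hb x ⟨hMN hx,
    Metric.mem_ball_self hr⟩ (r / 2) (by positivity) (by linarith)).trans_lt ENNReal.ofReal_lt_top)

theorem ae_mem_vol (hMc : IsCompact M) : ∀ᵐ x ∂(vol m M), x ∈ M :=
  ae_restrict_mem hMc.measurableSet

theorem continuousOn_normalCoord (hN : IsSubmanifold m N) (hMc : IsCompact M) (hMN : M ⊆ N) :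
    ∃ r > 0, ContinuousOn (fun p : Amb d × Amb d => normalCoord N p.1 p.2)
      {p | p.1 ∈ M ∧ p.2 ∈ M ∧ dist p.2 p.1 < r} := by
  have key : ∃ r > 0, ∃ C > (0 : ℝ), ∀ y ∈ M, ∀ x ∈ M, dist x y < r → ContinuousWithinAt
      (fun p : Amb d × Amb d => normalCoord N p.1 p.2) (M ×ˢ M) (y, x) := by
    refine exists_uniform_constants hMc (p := fun r _ y => ∀ x ∈ M, dist x y < r →
      ContinuousWithinAt (fun p : Amb d × Amb d => normalCoord N p.1 p.2) (M ×ˢ M) (y, x))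
      (fun r r' C C' y hr hC hp x hx hxy => hp x hx (hxy.trans_le hr)) fun x₀ hx₀ => ?_
    obtain ⟨s, hs, C, hC, -, hlip⟩ := exists_ball_normalCoord hN (hMN hx₀)
    refine ⟨s / 2, by positivity, 1, one_pos, fun y hy x hx hxy => ?_⟩
    have hys : y ∈ Metric.ball x₀ s := Metric.ball_subset_ball (by linarith) hy.2
    have hxs : x ∈ Metric.ball x₀ s := by
      have h1 := Metric.mem_ball.1 hy.2
      rw [Metric.mem_ball]
      linarith [dist_triangle x y x₀]
    have hmem : ((M ∩ Metric.ball x₀ s) ×ˢ (M ∩ Metric.ball x₀ s)) ∈ 𝓝[M ×ˢ M] (y, x) := by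
      rw [nhdsWithin_prod_eq]
      exact prod_mem_prod
        (inter_mem_nhdsWithin _ (Metric.isOpen_ball.mem_nhds hys))
        (inter_mem_nhdsWithin _ (Metric.isOpen_ball.mem_nhds hxs))
    have hL : LipschitzOnWith 4 (fun p : Amb d × Amb d => normalCoord N p.1 p.2)
        ((M ∩ Metric.ball x₀ s) ×ˢ (M ∩ Metric.ball x₀ s)) := by
      refine LipschitzOnWith.of_dist_le_mul fun p hp q hq => ?_
      rw [dist_eq_norm]
      refine (hlip p.1 ⟨hMN hp.1.1, hp.1.2⟩ p.2 ⟨hMN hp.2.1, hp.2.2⟩ q.1 ⟨hMN hq.1.1, hq.1.2⟩ q.2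
        ⟨hMN hq.2.1, hq.2.2⟩).trans ?_
      rw [Prod.dist_eq, ← dist_eq_norm, ← dist_eq_norm]
      have h1 := le_max_left (dist p.1 q.1) (dist p.2 q.2)
      have h2 := le_max_right (dist p.1 q.1) (dist p.2 q.2)
      push_cast
      linarith
    exact (hL.continuousOn (y, x) ⟨⟨hy.1, hys⟩, ⟨hx, hxs⟩⟩).mono_of_mem_nhdsWithin hmem
  obtain ⟨r, hr, C, hC, h⟩ := key
  exact ⟨r, hr, fun p hp => (h p.1 hp.1 p.2 hp.2.1 hp.2.2).mono fun q hq => ⟨hq.1, hq.2.1⟩⟩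

/-- Functions in `C^∞(M)` are, up to third order, polynomials of degree two in normal
coordinates. -/
theorem SmoothOnSet.exists_polynomial_approx (hN : IsSubmanifold m N) (hMc : IsCompact M)
    (hMN : M ⊆ N) {f : Amb d → ℝ} (hf : SmoothOnSet M f) :
    ∃ r > 0, ∃ C > 0, ∀ y ∈ M, ∃ p ∈ MvPolynomial.restrictTotalDegree (Fin d) ℝ 2,
      ∀ x ∈ M, dist x y < r → |f x - MvPolynomial.eval (normalCoord N y x) p| ≤
        C * dist x y ^ 3 := by
  refine exists_uniform_constants hMc (fun r r' C C' y hr hC hp => ?_) fun x₀ hx₀ => ?_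
  · obtain ⟨p, hp2, hp⟩ := hp
    refine ⟨p, hp2, fun x hx hxy => (hp x hx (hxy.trans_le hr)).trans ?_⟩
    gcongr
  · obtain ⟨U, hU, hxU, F, hF, hfF⟩ := hf x₀ hx₀
    obtain ⟨ρ, hρ, K, hK, hT⟩ := exists_taylor_expFiber hN (hMN hx₀) hU hxU hF
    obtain ⟨s, hs, C, hC, hν, -⟩ := exists_ball_normalCoord hN (hMN hx₀)
    obtain ⟨δ, hδ, hδU⟩ := Metric.isOpen_iff.1 hU x₀ hxU
    -- The bound `ρ / C` keeps normal coordinate vectors within the range `ρ` of the Taylor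
    -- estimate; halving `t` below keeps `x` in the `t`-ball as well as `y`.
    set t := min (min ρ δ) (min s (ρ / C)) with ht
    have ht0 : 0 < t := by positivity
    have htC : t * C ≤ ρ :=
      (le_div_iff₀ hC).1 ((min_le_right _ _).trans (min_le_right _ _))
    have htρ : Metric.ball x₀ t ⊆ Metric.ball x₀ ρ :=
      Metric.ball_subset_ball ((min_le_left _ _).trans (min_le_left _ _))
    have htU : Metric.ball x₀ t ⊆ U :=
      (Metric.ball_subset_ball ((min_le_left _ _).trans (min_le_right _ _))).trans hδU
    have hts : Metric.ball x₀ t ⊆ Metric.ball x₀ s :=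
      Metric.ball_subset_ball ((min_le_right _ _).trans (min_le_left _ _))
    refine ⟨t / 2, by positivity, K * C ^ 3, by positivity, fun y hy => ?_⟩
    have hyt : y ∈ Metric.ball x₀ t := Metric.ball_subset_ball (by linarith) hy.2
    obtain ⟨l, q, hlq⟩ := hT y (htρ hyt)
    obtain ⟨p, hp2, hp⟩ := exists_mvPolynomial_eval_eq (F y) l q
    refine ⟨p, hp2, fun x hx hxy => ?_⟩
    have hxt : x ∈ Metric.ball x₀ t := by
      have h1 := Metric.mem_ball.1 hy.2
      rw [Metric.mem_ball]
      linarith [dist_triangle x y x₀]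
    obtain ⟨hmem, hle⟩ := hν y ⟨hMN hy.1, hts hyt⟩ x ⟨hMN hx, hts hxt⟩
    rw [← dist_eq_norm] at hle
    have hle' : ‖normalCoord N y x‖ ≤ ρ := by
      refine hle.trans (le_trans ?_ htC)
      nlinarith
    rw [hp, hfF ⟨htU hxt, hx⟩]
    refine (hlq x _ hmem hle').trans ?_
    calc K * ‖normalCoord N y x‖ ^ 3 ≤ K * (C * dist x y) ^ 3 := by gcongr
      _ = K * C ^ 3 * dist x y ^ 3 := by ring

theorem SmoothOnSet.continuousOn {f : Amb d → ℝ} (hf : SmoothOnSet M f) : ContinuousOn f M := by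
  intro x hx
  obtain ⟨U, hU, hxU, F, hF, hfF⟩ := hf x hx
  have h1 : ContinuousWithinAt F (U ∩ M) x :=
    (hF.continuousOn x hxU).mono inter_subset_left
  have h2 := h1.congr hfF (hfF ⟨hxU, hx⟩)
  exact h2.mono_of_mem_nhdsWithin (inter_comm U M ▸ inter_mem_nhdsWithin _ (hU.mem_nhds hxU))

theorem SmoothOnSet.memLp {f : Amb d → ℝ} (hf : SmoothOnSet M f) (hMc : IsCompact M)
    [IsFiniteMeasure (vol m M)] : MemLp f 2 (vol m M) := by
  obtain ⟨C, hC⟩ := hMc.exists_bound_of_continuousOn hf.continuousOn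
  exact MemLp.of_bound (hf.continuousOn.aestronglyMeasurable hMc.measurableSet) C
    ((ae_mem_vol hMc).mono hC)

end Compactness

/-! ### Measurable families in `L²(M)` and their projections. -/

section Measurability

/-- Orthogonal projection onto the span of finitely many measurable vector fields is measurable. -/
theorem exists_aestronglyMeasurable_projection {α ι H : Type*} [MeasurableSpace α] {μ : Measure α}
    [NormedAddCommGroup H] [InnerProductSpace ℝ H] {b : ι → α → H}
    (hb : ∀ i, AEStronglyMeasurable (b i) μ) (s : Finset ι) :
    ∀ g : α → H, AEStronglyMeasurable g μ → ∃ Q : α → H, AEStronglyMeasurable Q μ ∧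
      ∀ y, Q y ∈ Submodule.span ℝ ((fun i => b i y) '' s) ∧
        ∀ i ∈ s, inner ℝ (b i y) (g y - Q y) = 0 := by
  classical
  induction s using Finset.induction_on with
  | empty => exact fun g _ => ⟨0, aestronglyMeasurable_zero, by simp⟩
  | insert i s _ ih =>
    intro g hg
    obtain ⟨Q, hQ, hQs⟩ := ih g hg
    obtain ⟨R, hR, hRs⟩ := ih (b i) (hb i)
    have hspan : ∀ y v, (∀ j ∈ s, inner ℝ (b j y) v = 0) →
        ∀ w ∈ Submodule.span ℝ ((fun i => b i y) '' s), inner ℝ w v = 0 := by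
      intro y v hv w hw
      induction hw using Submodule.span_induction with
      | mem w hw =>
        obtain ⟨j, hj, rfl⟩ := hw
        exact hv j hj
      | zero => simp
      | add w w' _ _ h h' => rw [inner_add_left, h, h', add_zero]
      | smul c w _ h => rw [inner_smul_left, h, mul_zero]
    have hc : AEStronglyMeasurable (fun y => b i y - R y) μ := (hb i).sub hR
    -- One Gram-Schmidt step with the component `b i y - R y` orthogonal to the earlier vectors.
    -- Where it vanishes the added term is zero, so linear dependence and a rank that varies with
    -- `y` do no harm.
    refine ⟨fun y => Q y + ((‖b i y - R y‖ ^ 2)⁻¹ * inner ℝ (b i y - R y) (g y)) • (b i y - R y),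
      hQ.add (AEStronglyMeasurable.smul (f := fun y => (‖b i y - R y‖ ^ 2)⁻¹ *
        inner ℝ (b i y - R y) (g y)) ?_ hc), fun y => ⟨?_, ?_⟩⟩
    · exact ((hc.norm.aemeasurable.pow_const 2).inv.aestronglyMeasurable).mul (hc.inner hg)
    · have hsub : Submodule.span ℝ ((fun i => b i y) '' s) ≤
          Submodule.span ℝ ((fun i => b i y) '' (insert i s : Finset ι)) := by
        refine Submodule.span_mono (image_mono ?_)
        simp
      refine Submodule.add_mem _ (hsub (hQs y).1) (Submodule.smul_mem _ _
        (Submodule.sub_mem _ (Submodule.subset_span ⟨i, by simp, rfl⟩) (hsub (hRs y).1)))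
    · have horth : ∀ j ∈ s, inner ℝ (b j y) (g y - (Q y + ((‖b i y - R y‖ ^ 2)⁻¹ *
          inner ℝ (b i y - R y) (g y)) • (b i y - R y))) = 0 := by
        intro j hj
        rw [← sub_sub, inner_sub_right, (hQs y).2 j hj, inner_smul_right, (hRs y).2 j hj]
        simp
      intro j hj
      rcases Finset.mem_insert.1 hj with rfl | hj
      · have h1 := hspan y _ horth _ (hRs y).1
        have h2 : inner ℝ (b j y - R y) (Q y) = 0 := by
          rw [real_inner_comm]
          exact hspan y _ (hRs y).2 _ (hQs y).1
        have h3 : inner ℝ (b j y - R y) (g y - (Q y + ((‖b j y - R y‖ ^ 2)⁻¹ *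
            inner ℝ (b j y - R y) (g y)) • (b j y - R y))) = 0 := by
          rw [← sub_sub, inner_sub_right, inner_sub_right, h2, inner_smul_right,
            real_inner_self_eq_norm_sq]
          rcases eq_or_ne (b j y - R y) 0 with h0 | h0
          · simp [h0]
          · have : ‖b j y - R y‖ ^ 2 ≠ 0 := by simpa using h0
            field_simp
            ring
        have h4 := inner_add_left (𝕜 := ℝ) (b j y - R y) (R y) (g y - (Q y +
          ((‖b j y - R y‖ ^ 2)⁻¹ * inner ℝ (b j y - R y) (g y)) • (b j y - R y)))
        rwa [sub_add_cancel, h3, h1, add_zero] at h4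
      · exact horth j hj

variable {d m : ℕ} {M : Set (Amb d)}

/-- Uniform continuity on `M ×ˢ M` gives continuity in the sup norm, which controls the `L²` norm
since the measure is finite. -/
theorem continuousOn_toLp [IsFiniteMeasure (vol m M)] (hMc : IsCompact M)
    {k : Amb d × Amb d → ℝ} (hk : ContinuousOn k (M ×ˢ M)) {T : Amb d → L2 m M}
    (hT : ∀ y ∈ M, T y =ᵐ[vol m M] fun x => k (y, x)) : ContinuousOn T M := by
  have huc := (hMc.prod hMc).uniformContinuousOn_of_continuous hk
  rw [Metric.uniformContinuousOn_iff] at huc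
  rw [Metric.continuousOn_iff]
  intro y hy ε hε
  set c : ℝ := measureUnivNNReal (vol m M) ^ (2 : ENNReal).toReal⁻¹ with hc
  have hc0 : 0 ≤ c := by positivity
  obtain ⟨δ, hδ, h⟩ := huc (ε / (c + 1)) (by positivity)
  refine ⟨δ, hδ, fun z hz hzy => ?_⟩
  have hb : ∀ᵐ x ∂(vol m M), ‖(T z - T y) x‖ ≤ ε / (c + 1) := by
    filter_upwards [Lp.coeFn_sub (T z) (T y), hT z hz, hT y hy, ae_mem_vol hMc] with x h1 h2 h3 hx
    rw [h1, Pi.sub_apply, h2, h3, ← dist_eq_norm]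
    refine (h (z, x) ⟨hz, hx⟩ (y, x) ⟨hy, hx⟩ ?_).le
    simpa [Prod.dist_eq] using hzy
  rw [dist_eq_norm]
  refine (Lp.norm_le_of_ae_bound (by positivity) hb).trans_lt ?_
  change c * (ε / (c + 1)) < ε
  rw [mul_div_assoc', div_lt_iff₀ (by positivity)]
  nlinarith

/-- Dominated convergence in `L²(M)`. -/
theorem tendsto_L2_of_dominated [IsFiniteMeasure (vol m M)] {F : ℕ → L2 m M} {f : L2 m M} {C : ℝ}
    (hb : ∀ n, ∀ᵐ x ∂(vol m M), ‖F n x - f x‖ ≤ C)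
    (hlim : ∀ᵐ x ∂(vol m M), Tendsto (fun n => F n x) atTop (𝓝 (f x))) :
    Tendsto F atTop (𝓝 f) := by
  rw [tendsto_iff_norm_sub_tendsto_zero]
  have hsq : Tendsto (fun n => ‖F n - f‖ ^ 2) atTop (𝓝 0) := by
    have h0 : ∀ n, ‖F n - f‖ ^ 2 = ∫ x, (F n x - f x) ^ 2 ∂(vol m M) := by
      intro n
      rw [← real_inner_self_eq_norm_sq, L2.inner_def]
      refine integral_congr_ae ?_
      filter_upwards [Lp.coeFn_sub (F n) f] with x hx
      rw [hx, Pi.sub_apply, real_inner_self_eq_norm_sq, Real.norm_eq_abs, sq_abs]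
    simp_rw [h0]
    rw [← integral_zero (Amb d) ℝ (μ := vol m M)]
    refine tendsto_integral_of_dominated_convergence (fun _ => C ^ 2)
      (fun n => (((Lp.aestronglyMeasurable (F n)).sub (Lp.aestronglyMeasurable f)).pow 2))
      (integrable_const _) (fun n => ?_) ?_
    · filter_upwards [hb n] with x hx
      rw [norm_pow]
      gcongr
    · filter_upwards [hlim] with x hx
      simpa using ((hx.sub_const (f x)).pow 2)
  have := hsq.sqrt
  simpa using this

/-- Continuous cutoffs approximating the indicator function of `(-∞, h)` from below. -/
theorem tendsto_cutoff (h t : ℝ) :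
    Tendsto (fun n : ℕ => min 1 ((n : ℝ) * max 0 (h - t))) atTop
      (𝓝 ((Iio h).indicator (fun _ => 1) t)) := by
  by_cases ht : t < h
  · rw [indicator_of_mem (by exact ht)]
    have h1 : Tendsto (fun n : ℕ => (n : ℝ) * max 0 (h - t)) atTop atTop :=
      tendsto_natCast_atTop_atTop.atTop_mul_const (lt_max_of_lt_right (by linarith))
    refine tendsto_const_nhds.congr' ?_
    filter_upwards [h1.eventually_ge_atTop 1] with n hn using (min_eq_left hn).symm
  · rw [indicator_of_notMem (by exact ht)]
    refine tendsto_const_nhds.congr fun n => ?_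
    rw [max_eq_left (by linarith), mul_zero, min_eq_right zero_le_one]

variable {k : Amb d × Amb d → ℝ} {r h : ℝ}

theorem exists_bound_kernel (hMc : IsCompact M)
    (hk : ContinuousOn k {p | p.1 ∈ M ∧ p.2 ∈ M ∧ dist p.2 p.1 < r}) (hr : h < r) :
    ∃ C, ∀ y ∈ M, ∀ x ∈ M, dist x y ≤ h → ‖k (y, x)‖ ≤ C := by
  have hcl : IsClosed {p : Amb d × Amb d | dist p.2 p.1 ≤ h} :=
    isClosed_le (by fun_prop) continuous_const
  obtain ⟨C, hC⟩ := ((hMc.prod hMc).inter_right hcl).exists_bound_of_continuousOn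
    (hk.mono fun p hp => ⟨hp.1.1, hp.1.2, lt_of_le_of_lt hp.2 hr⟩)
  exact ⟨C, fun y hy x hx hxy => hC (y, x) ⟨⟨hy, hx⟩, hxy⟩⟩

theorem memLp_indicator_kernel [IsFiniteMeasure (vol m M)] (hMc : IsCompact M)
    (hk : ContinuousOn k {p | p.1 ∈ M ∧ p.2 ∈ M ∧ dist p.2 p.1 < r}) (hr : h < r)
    {y : Amb d} (hy : y ∈ M) :
    MemLp ((Metric.ball y h).indicator fun x => k (y, x)) 2 (vol m M) := by
  obtain ⟨C, hC⟩ := exists_bound_kernel hMc hk hr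
  refine MemLp.of_bound ?_ (max C 0) ?_
  · rw [aestronglyMeasurable_indicator_iff measurableSet_ball, vol,
      Measure.restrict_restrict measurableSet_ball]
    refine ContinuousOn.aestronglyMeasurable ?_ (measurableSet_ball.inter hMc.measurableSet)
    exact hk.comp (by fun_prop) fun x hx => ⟨hy, hx.2, (Metric.mem_ball.1 hx.1).trans hr⟩
  · filter_upwards [ae_mem_vol hMc] with x hx
    by_cases hxb : x ∈ Metric.ball y h
    · rw [indicator_of_mem hxb]
      exact (hC y hy x hx (Metric.mem_ball.1 hxb).le).trans (le_max_left _ _)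
    · rw [indicator_of_notMem hxb, norm_zero]
      exact le_max_right _ _

/-- A kernel that is continuous near the diagonal, cut off at distance `h`, is a measurable family
of elements of `L²(M)`. -/
theorem aestronglyMeasurable_indicator_kernel [IsFiniteMeasure (vol m M)] (hMc : IsCompact M)
    (hk : ContinuousOn k {p | p.1 ∈ M ∧ p.2 ∈ M ∧ dist p.2 p.1 < r}) (hr : h < r)
    {T : Amb d → L2 m M}
    (hT : ∀ y ∈ M, T y =ᵐ[vol m M] (Metric.ball y h).indicator fun x => k (y, x)) :
    AEStronglyMeasurable T (vol m M) := by
  obtain ⟨C, hC⟩ := exists_bound_kernel hMc hk hr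
  set χ : ℕ → ℝ → ℝ := fun n t => min 1 ((n : ℝ) * max 0 (h - t)) with hχ
  have hχ0 : ∀ n t, h ≤ t → χ n t = 0 := fun n t ht => by
    simp only [hχ]
    rw [max_eq_left (by linarith), mul_zero, min_eq_right zero_le_one]
  have hχ1 : ∀ n t, |χ n t| ≤ 1 := fun n t => by
    rw [abs_of_nonneg (by positivity)]
    exact min_le_left _ _
  set κ : ℕ → Amb d × Amb d → ℝ := fun n p => χ n (dist p.2 p.1) * k p with hκ
  -- Within distance `r` the kernel itself is continuous; at distance at least `r > h` the cutoff
  -- vanishes on a neighborhood, whatever `k` does there.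
  have hκc : ∀ n, ContinuousOn (κ n) (M ×ˢ M) := by
    intro n p hp
    by_cases hpr : dist p.2 p.1 < r
    · have h1 : ContinuousWithinAt k (M ×ˢ M) p := by
        refine (hk p ⟨hp.1, hp.2, hpr⟩).mono_of_mem_nhdsWithin ?_
        have : {q : Amb d × Amb d | dist q.2 q.1 < r} ∈ 𝓝 p :=
          (isOpen_lt (by fun_prop) continuous_const).mem_nhds hpr
        filter_upwards [self_mem_nhdsWithin, mem_nhdsWithin_of_mem_nhds this] with q hq hq'
        exact ⟨hq.1, hq.2, hq'⟩
      have h2 : Continuous fun p : Amb d × Amb d => χ n (dist p.2 p.1) := by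
        simp only [hχ]
        fun_prop
      exact h2.continuousWithinAt.mul h1
    · have : {q : Amb d × Amb d | h < dist q.2 q.1} ∈ 𝓝 p :=
        (isOpen_lt continuous_const (by fun_prop)).mem_nhds (hr.trans_le (not_lt.1 hpr))
      refine ContinuousAt.continuousWithinAt ((continuousAt_const (y := (0 : ℝ))).congr ?_)
      filter_upwards [this] with q hq
      simp only [hκ]
      rw [hχ0 n _ (le_of_lt hq), zero_mul]
  have hκb : ∀ n, ∀ y ∈ M, ∀ x ∈ M, |κ n (y, x)| ≤ |C| := by
    intro n y hy x hx
    simp only [hκ]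
    by_cases hxy : dist x y ≤ h
    · rw [abs_mul]
      calc |χ n (dist x y)| * |k (y, x)| ≤ 1 * |C| :=
            mul_le_mul (hχ1 _ _) ((hC y hy x hx hxy).trans (le_abs_self C)) (abs_nonneg _)
              zero_le_one
        _ = |C| := one_mul _
    · rw [hχ0 n _ (not_le.1 hxy).le, zero_mul, abs_zero]
      exact abs_nonneg _
  have hκm : ∀ n, ∀ y ∈ M, MemLp (fun x => κ n (y, x)) 2 (vol m M) := by
    intro n y hy
    refine MemLp.of_bound ?_ |C| ((ae_mem_vol hMc).mono fun x hx => hκb n y hy x hx)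
    exact ((hκc n).comp (by fun_prop) fun x hx => ⟨hy, hx⟩).aestronglyMeasurable
      hMc.measurableSet
  classical
  set S : ℕ → Amb d → L2 m M := fun n y => if hy : y ∈ M then (hκm n y hy).toLp _ else 0 with hS
  have hSe : ∀ n, ∀ y ∈ M, S n y =ᵐ[vol m M] fun x => κ n (y, x) := by
    intro n y hy
    simp only [hS, dif_pos hy]
    exact (hκm n y hy).coeFn_toLp
  refine aestronglyMeasurable_of_tendsto_ae atTop (f := S) (fun n =>
    (continuousOn_toLp hMc (hκc n) (hSe n)).aestronglyMeasurable hMc.measurableSet) ?_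
  filter_upwards [ae_mem_vol hMc] with y hy
  have hTb : ∀ᵐ x ∂(vol m M), |T y x| ≤ |C| := by
    filter_upwards [hT y hy, ae_mem_vol hMc] with x h1 hx
    rw [h1]
    by_cases hxb : x ∈ Metric.ball y h
    · rw [indicator_of_mem hxb]
      exact (hC y hy x hx (Metric.mem_ball.1 hxb).le).trans (le_abs_self C)
    · rw [indicator_of_notMem hxb, abs_zero]
      exact abs_nonneg _
  refine tendsto_L2_of_dominated (C := |C| + |C|) (fun n => ?_) ?_
  · filter_upwards [hTb, hSe n y hy, ae_mem_vol hMc] with x h1 h2 hx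
    refine (norm_sub_le _ _).trans (add_le_add ?_ h1)
    rw [h2]
    exact hκb n y hy x hx
  · filter_upwards [hT y hy, ae_all_iff.2 fun n => hSe n y hy] with x h1 h2
    simp_rw [h1, h2]
    have := (tendsto_cutoff h (dist x y)).mul_const (k (y, x))
    convert! this using 2
    by_cases hxb : dist x y < h <;> simp [indicator, hxb]

end Measurability

end ManifoldLearning

namespace ManifoldLearning

/-! ### Residuals of local regression and the pointwise estimate in `y`. -/

section LocalRegression

variable {d m : ℕ} {M N : Set (Amb d)} {h : ℝ} {y : Amb d}

theorem coeFn_restrictBall (F : L2 m M) :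
    restrictBall m M h y F =ᵐ[vol m M] (Metric.ball y h).indicator F :=
  MemLp.coeFn_toLp _

theorem norm_restrictBall_le (F : L2 m M) : ‖restrictBall m M h y F‖ ≤ ‖F‖ := by
  refine Lp.norm_le_norm_of_ae_le ?_
  filter_upwards [coeFn_restrictBall (h := h) (y := y) F] with x hx
  rw [hx]
  exact norm_indicator_le_norm_self _ _

theorem inner_restrictBall (F G : L2 m M) :
    inner ℝ (restrictBall m M h y F) G = inner ℝ F (restrictBall m M h y G) := by
  rw [L2.inner_def, L2.inner_def]
  refine integral_congr_ae ?_
  filter_upwards [coeFn_restrictBall (h := h) (y := y) F,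
    coeFn_restrictBall (h := h) (y := y) G] with x h1 h2
  rw [h1, h2]
  by_cases hx : x ∈ Metric.ball y h <;> simp [hx]

theorem polySpace_mono {k l : ℕ} (hkl : k ≤ l) :
    polySpace m M N h k y ≤ polySpace m M N h l y := by
  rintro F ⟨p, hp, hF⟩
  refine ⟨p, ?_, hF⟩
  rw [MvPolynomial.mem_restrictTotalDegree] at *
  exact hp.trans hkl

/-- The right-hand side lies in `V ⊓ Uᗮ`, and `f` minus it is the sum of `f - V.starProjection f`
and `U.starProjection f`, both orthogonal to `V ⊓ Uᗮ`. -/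
theorem starProjection_inf_orthogonal {H : Type*} [NormedAddCommGroup H] [InnerProductSpace ℝ H]
    {U V : Submodule ℝ H} [U.HasOrthogonalProjection] [V.HasOrthogonalProjection]
    [(V ⊓ Uᗮ).HasOrthogonalProjection] (hUV : U ≤ V) (f : H) :
    (V ⊓ Uᗮ).starProjection f = V.starProjection f - U.starProjection f := by
  refine Submodule.eq_starProjection_of_mem_orthogonal ⟨?_, ?_⟩ ?_
  · exact V.sub_mem (V.starProjection_apply_mem f) (hUV (U.starProjection_apply_mem f))
  · have h1 : f - V.starProjection f ∈ Uᗮ :=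
      Submodule.orthogonal_le hUV (V.sub_starProjection_mem_orthogonal f)
    have := Uᗮ.sub_mem (U.sub_starProjection_mem_orthogonal f) h1
    rwa [sub_sub_sub_cancel_left] at this
  · have h1 : f - V.starProjection f ∈ (V ⊓ Uᗮ)ᗮ :=
      Submodule.orthogonal_le inf_le_left (V.sub_starProjection_mem_orthogonal f)
    have h2 : U.starProjection f ∈ (V ⊓ Uᗮ)ᗮ :=
      Submodule.orthogonal_le inf_le_right
        (Submodule.le_orthogonal_orthogonal U (U.starProjection_apply_mem f))
    have := (V ⊓ Uᗮ)ᗮ.add_mem h1 h2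
    rwa [sub_add] at this

theorem localHLLE_eq (F : L2 m M) :
    localHLLE m M N h y F = (polySpace m M N h 2 y).starProjection F -
      (polySpace m M N h 1 y).starProjection F :=
  starProjection_inf_orthogonal (U := polySpace m M N h 1 y) (V := polySpace m M N h 2 y)
    (polySpace_mono one_le_two) F

theorem localLTSA_sub_localHLLE (F : L2 m M) :
    localLTSA m M N h y F - localHLLE m M N h y F =
      restrictBall m M h y F - (polySpace m M N h 2 y).starProjection F := by
  rw [localLTSA, localHLLE_eq]
  abel

theorem restrictBall_of_mem_polySpace {k : ℕ} {F : L2 m M} (hF : F ∈ polySpace m M N h k y) :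
    restrictBall m M h y F = F := by
  obtain ⟨p, -, hp⟩ := hF
  refine Lp.ext ?_
  filter_upwards [coeFn_restrictBall (h := h) (y := y) F, hp] with x h1 h2
  rw [h1]
  by_cases hx : x ∈ Metric.ball y h
  · rw [indicator_of_mem hx]
  · rw [indicator_of_notMem hx, h2, localPolyFun, indicator_of_notMem hx]

/-- The residual of a regression tests to second order: its pairing with `G` is bounded by the
product of the errors of arbitrary approximations. -/
theorem abs_inner_residual_le {k : ℕ} (F G : L2 m M) {p q : L2 m M}
    (hp : p ∈ polySpace m M N h k y) (hq : q ∈ polySpace m M N h k y) :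
    |inner ℝ G (restrictBall m M h y F - (polySpace m M N h k y).starProjection F)| ≤
      ‖restrictBall m M h y G - q‖ * ‖restrictBall m M h y F - p‖ := by
  set V := polySpace m M N h k y with hV
  set E := restrictBall m M h y F - V.starProjection F with hE
  -- Elements of `V` vanish off the ball, so they pair with `F` and with its restriction alike.
  have horth : ∀ w ∈ V, inner ℝ w E = 0 := by
    intro w hw
    rw [hE, inner_sub_right, ← inner_restrictBall, restrictBall_of_mem_polySpace hw,
      ← inner_sub_right]
    exact (V.mem_orthogonal _).1 (V.sub_starProjection_mem_orthogonal F) w hw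
  have hEE : restrictBall m M h y E = E := by
    have hVF := restrictBall_of_mem_polySpace (V.starProjection_apply_mem F)
    refine Lp.ext ?_
    filter_upwards [coeFn_restrictBall (h := h) (y := y) E,
      coeFn_restrictBall (h := h) (y := y) F,
      coeFn_restrictBall (h := h) (y := y) (V.starProjection F),
      Lp.coeFn_sub (restrictBall m M h y F) (V.starProjection F)] with x h1 h2 h3 h4
    rw [hVF] at h3
    rw [h1]
    by_cases hx : x ∈ Metric.ball y h
    · rw [indicator_of_mem hx]
    · rw [indicator_of_notMem hx, hE, h4, Pi.sub_apply, h2, h3, indicator_of_notMem hx,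
        indicator_of_notMem hx, sub_zero]
  have hEn : ‖E‖ ≤ ‖restrictBall m M h y F - p‖ := by
    have h1 : inner ℝ (restrictBall m M h y F - p) E = ‖E‖ ^ 2 := by
      have : restrictBall m M h y F - p = E + (V.starProjection F - p) := by
        rw [hE]
        abel
      rw [this, inner_add_left, horth _ (V.sub_mem (V.starProjection_apply_mem F) hp), add_zero,
        real_inner_self_eq_norm_sq]
    have h2 := real_inner_le_norm (restrictBall m M h y F - p) E
    rw [h1, sq] at h2
    rcases (norm_nonneg E).eq_or_lt with h0 | h0
    · rw [← h0]
      exact norm_nonneg _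
    · exact le_of_mul_le_mul_right h2 h0
  -- `E` is supported in the ball and orthogonal to `V`, so `G` may be restricted and changed by `q`
  -- at no cost.
  have hG : inner ℝ G E = inner ℝ (restrictBall m M h y G - q) E := by
    rw [inner_sub_left, horth q hq, sub_zero, inner_restrictBall, hEE]
  rw [hG]
  exact (abs_real_inner_le_norm _ _).trans (by gcongr)

/-- `L²` norm of the error of a local polynomial approximation. -/
theorem norm_restrictBall_sub_le [IsFiniteMeasure (vol m M)] (hMc : IsCompact M) {f : Amb d → ℝ}
    (hf : MemLp f 2 (vol m M)) {p : MvPolynomial (Fin d) ℝ} {q : L2 m M}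
    (hq : q =ᵐ[vol m M] localPolyFun N h y p) {c : ℝ}
    (hc : ∀ x ∈ M, dist x y < h → |f x - MvPolynomial.eval (normalCoord N y x) p| ≤ c) :
    ‖restrictBall m M h y (hf.toLp f) - q‖ ≤ |c| * √((vol m M).real (Metric.ball y h)) := by
  have hμ : vol m M (Metric.ball y h) ≠ ⊤ := measure_ne_top _ _
  have hle : ‖restrictBall m M h y (hf.toLp f) - q‖ ≤
      ‖indicatorConstLp 2 measurableSet_ball hμ c‖ := by
    refine Lp.norm_le_norm_of_ae_le ?_
    filter_upwards [Lp.coeFn_sub (restrictBall m M h y (hf.toLp f)) q,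
      coeFn_restrictBall (h := h) (y := y) (hf.toLp f), hq, hf.coeFn_toLp, ae_mem_vol hMc,
      indicatorConstLp_coeFn (p := 2) (hs := measurableSet_ball) (hμs := hμ) (c := c)]
      with x h1 h2 h3 h4 hx h5
    rw [h1, Pi.sub_apply, h2, h3, h5, localPolyFun]
    by_cases hxb : x ∈ Metric.ball y h
    · rw [indicator_of_mem hxb, indicator_of_mem hxb, indicator_of_mem hxb, h4]
      exact (hc x hx hxb).trans (le_abs_self c)
    · simp [indicator_of_notMem hxb]
  refine hle.trans_eq ?_
  rw [norm_indicatorConstLp two_ne_zero ENNReal.ofNat_ne_top, Real.sqrt_eq_rpow, Real.norm_eq_abs]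
  simp

/-- Polynomials in normal coordinates at `y`, as elements of `L²(M)`. -/
noncomputable def polyToLp (hm : ∀ p, MemLp (localPolyFun N h y p) 2 (vol m M)) :
    MvPolynomial (Fin d) ℝ →ₗ[ℝ] L2 m M where
  toFun p := (hm p).toLp _
  map_add' p q := by
    rw [← MemLp.toLp_add]
    congr 1
    exact localPolyFun_add N h y _ _
  map_smul' c p := by
    rw [RingHom.id_apply, ← MemLp.toLp_const_smul]
    congr 1
    exact localPolyFun_smul N h y _ _

theorem polySpace_eq_map (hm : ∀ p, MemLp (localPolyFun N h y p) 2 (vol m M)) (k : ℕ) :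
    polySpace m M N h k y =
      (MvPolynomial.restrictTotalDegree (Fin d) ℝ k).map (polyToLp hm) := by
  ext F
  constructor
  · rintro ⟨p, hp, hF⟩
    exact ⟨p, hp, Lp.ext ((hm p).coeFn_toLp.trans hF.symm)⟩
  · rintro ⟨p, hp, rfl⟩
    exact ⟨p, hp, (hm p).coeFn_toLp⟩

section Measurable

variable [IsFiniteMeasure (vol m M)] {r : ℝ}

theorem continuousOn_eval_normalCoord
    (hν : ContinuousOn (fun p : Amb d × Amb d => normalCoord N p.1 p.2)
      {p | p.1 ∈ M ∧ p.2 ∈ M ∧ dist p.2 p.1 < r}) (p : MvPolynomial (Fin d) ℝ) :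
    ContinuousOn (fun q : Amb d × Amb d => MvPolynomial.eval (normalCoord N q.1 q.2) p)
      {p | p.1 ∈ M ∧ p.2 ∈ M ∧ dist p.2 p.1 < r} := by
  have h1 : Continuous fun v : Amb d => MvPolynomial.eval v p :=
    (MvPolynomial.continuous_eval p).comp (PiLp.continuous_ofLp 2 _)
  exact h1.comp_continuousOn hν

theorem memLp_localPolyFun (hMc : IsCompact M)
    (hν : ContinuousOn (fun p : Amb d × Amb d => normalCoord N p.1 p.2)
      {p | p.1 ∈ M ∧ p.2 ∈ M ∧ dist p.2 p.1 < r}) (hr : h < r) (hy : y ∈ M)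
    (p : MvPolynomial (Fin d) ℝ) : MemLp (localPolyFun N h y p) 2 (vol m M) :=
  memLp_indicator_kernel hMc (continuousOn_eval_normalCoord hν p) hr hy

/-- A fixed basis of the polynomials on `ℝ^d` gives, for `y ∈ M`, a spanning family that is
measurable in `y`. It may be dependent, since only restrictions to `T_y N` matter, but the
projection lemma allows this. -/
theorem aestronglyMeasurable_starProjection (hMc : IsCompact M)
    (hν : ContinuousOn (fun p : Amb d × Amb d => normalCoord N p.1 p.2)
      {p | p.1 ∈ M ∧ p.2 ∈ M ∧ dist p.2 p.1 < r}) (hr : h < r) (k : ℕ) (F : L2 m M) :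
    AEStronglyMeasurable (fun y => (polySpace m M N h k y).starProjection F) (vol m M) := by
  classical
  let β := Module.finBasis ℝ (MvPolynomial.restrictTotalDegree (Fin d) ℝ k)
  let b : Fin _ → Amb d → L2 m M := fun i y =>
    if hy : y ∈ M then polyToLp (memLp_localPolyFun (N := N) (h := h) hMc hν hr hy) (β i) else 0
  have hb : ∀ i, AEStronglyMeasurable (b i) (vol m M) := fun i =>
    aestronglyMeasurable_indicator_kernel hMc (continuousOn_eval_normalCoord hν (β i)) hr
      fun y hy => by
        simp only [b, dif_pos hy]
        exact (memLp_localPolyFun hMc hν hr hy (β i)).coeFn_toLp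
  obtain ⟨Q, hQ, hQs⟩ := exists_aestronglyMeasurable_projection hb Finset.univ (fun _ => F)
    aestronglyMeasurable_const
  refine hQ.congr ?_
  filter_upwards [ae_mem_vol hMc] with y hy
  have hm := memLp_localPolyFun (m := m) (N := N) (h := h) hMc hν hr hy
  have hspan : polySpace m M N h k y =
      Submodule.span ℝ ((fun i => b i y) '' (Finset.univ : Finset (Fin (Module.finrank ℝ
        (MvPolynomial.restrictTotalDegree (Fin d) ℝ k))))) := by
    have h1 : Submodule.span ℝ (range fun i => (β i : MvPolynomial (Fin d) ℝ)) =
        MvPolynomial.restrictTotalDegree (Fin d) ℝ k := by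
      have := congrArg (Submodule.map (Submodule.subtype _)) β.span_eq
      rwa [Submodule.map_span, Submodule.map_subtype_top, ← range_comp] at this
    refine (polySpace_eq_map hm k).trans ((congrArg (Submodule.map _) h1.symm).trans ?_)
    rw [Submodule.map_span, ← range_comp, Finset.coe_univ, image_univ]
    congr 2
    ext1 i
    simp only [b, dif_pos hy, Function.comp_apply]
  refine (Submodule.eq_starProjection_of_mem_orthogonal ?_ ?_).symm
  · rw [hspan]
    exact (hQs y).1
  · rw [Submodule.mem_orthogonal, hspan]
    intro w hw
    induction hw using Submodule.span_induction with
    | mem w hw =>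
      obtain ⟨j, hj, rfl⟩ := hw
      exact (hQs y).2 j (Finset.mem_univ j)
    | zero => simp
    | add w w' _ _ h h' => rw [inner_add_left, h, h', add_zero]
    | smul c w _ h => rw [inner_smul_left, h, mul_zero]

theorem integrable_localLTSA (hMc : IsCompact M)
    (hν : ContinuousOn (fun p : Amb d × Amb d => normalCoord N p.1 p.2)
      {p | p.1 ∈ M ∧ p.2 ∈ M ∧ dist p.2 p.1 < r}) (hr : h < r) {f : Amb d → ℝ}
    (hfc : ContinuousOn f M) (hf : MemLp f 2 (vol m M)) :
    Integrable (fun y => localLTSA m M N h y (hf.toLp f)) (vol m M) := by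
  have hk : ContinuousOn (fun p : Amb d × Amb d => f p.2)
      {p | p.1 ∈ M ∧ p.2 ∈ M ∧ dist p.2 p.1 < r} :=
    hfc.comp continuousOn_snd fun p hp => hp.2.1
  have hI : AEStronglyMeasurable (fun y => restrictBall m M h y (hf.toLp f)) (vol m M) := by
    refine aestronglyMeasurable_indicator_kernel hMc hk hr fun y _ => ?_
    filter_upwards [coeFn_restrictBall (h := h) (y := y) (hf.toLp f), hf.coeFn_toLp] with x h1 h2
    rw [h1]
    by_cases hx : x ∈ Metric.ball y h <;> simp [hx, h2]
  refine Integrable.of_bound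
    (hI.sub (aestronglyMeasurable_starProjection hMc hν hr 1 (hf.toLp f)))
    (‖hf.toLp f‖ + ‖hf.toLp f‖) (Eventually.of_forall fun y => ?_)
  exact (norm_sub_le _ _).trans
    (add_le_add (norm_restrictBall_le _) (Submodule.norm_starProjection_apply_le _ _))

theorem integrable_localHLLE (hMc : IsCompact M)
    (hν : ContinuousOn (fun p : Amb d × Amb d => normalCoord N p.1 p.2)
      {p | p.1 ∈ M ∧ p.2 ∈ M ∧ dist p.2 p.1 < r}) (hr : h < r) (F : L2 m M) :
    Integrable (fun y => localHLLE m M N h y F) (vol m M) := by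
  refine Integrable.of_bound ?_ ‖F‖
    (Eventually.of_forall fun y => Submodule.norm_starProjection_apply_le _ _)
  simp_rw [localHLLE_eq]
  exact (aestronglyMeasurable_starProjection hMc hν hr 2 F).sub
    (aestronglyMeasurable_starProjection hMc hν hr 1 F)

end Measurable

/-- Pointwise in `y`, the local operators of LTSA and HLLE differ weakly by `O(h^6 Vol_h)`. -/
theorem exists_abs_inner_local_sub_le (hN : IsSubmanifold m N) (hMc : IsCompact M) (hMN : M ⊆ N)
    [IsFiniteMeasure (vol m M)] {f g : Amb d → ℝ} (hf : SmoothOnSet M f) (hg : SmoothOnSet M g)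
    (hf2 : MemLp f 2 (vol m M)) (hg2 : MemLp g 2 (vol m M)) :
    ∃ r > 0, ∃ C > 0, ∀ h, 0 < h → h < r → ∀ y ∈ M,
      |inner ℝ (hg2.toLp g) (localLTSA m M N h y (hf2.toLp f) - localHLLE m M N h y (hf2.toLp f))| ≤
        C * h ^ 6 * volBall m h := by
  obtain ⟨r₁, hr₁, hν⟩ := continuousOn_normalCoord hN hMc hMN
  obtain ⟨r₂, hr₂, Cf, hCf, hfa⟩ := hf.exists_polynomial_approx hN hMc hMN
  obtain ⟨r₃, hr₃, Cg, hCg, hga⟩ := hg.exists_polynomial_approx hN hMc hMN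
  obtain ⟨r₄, hr₄, Cv, hCv, hv⟩ := vol_ball_le hN hMc hMN
  refine ⟨min (min r₁ r₂) (min r₃ r₄), by positivity, Cg * Cf * Cv, by positivity,
    fun h hh hhr y hy => ?_⟩
  obtain ⟨⟨h₁, h₂⟩, h₃, h₄⟩ : (h < r₁ ∧ h < r₂) ∧ h < r₃ ∧ h < r₄ := by simpa using hhr
  have hm := memLp_localPolyFun (m := m) (N := N) (h := h) hMc hν h₁ hy
  have approx : ∀ {u : Amb d → ℝ} (hu : MemLp u 2 (vol m M)) {c s : ℝ}, 0 < c → h < s →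
      (∃ p ∈ MvPolynomial.restrictTotalDegree (Fin d) ℝ 2, ∀ x ∈ M, dist x y < s →
        |u x - MvPolynomial.eval (normalCoord N y x) p| ≤ c * dist x y ^ 3) →
      ∃ q ∈ polySpace m M N h 2 y, ‖restrictBall m M h y (hu.toLp u) - q‖ ≤
        c * h ^ 3 * √((vol m M).real (Metric.ball y h)) := by
    rintro u hu c s hc hs ⟨p, hp2, hp⟩
    refine ⟨(hm p).toLp _, ⟨p, hp2, (hm p).coeFn_toLp⟩, ?_⟩
    have h0 : 0 ≤ c * h ^ 3 := by positivity
    rw [← abs_of_nonneg h0]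
    refine norm_restrictBall_sub_le hMc hu (hm p).coeFn_toLp fun x hx hxy => ?_
    refine (hp x hx (hxy.trans hs)).trans ?_
    gcongr
  obtain ⟨p, hp, hpb⟩ := approx hf2 hCf h₂ (hfa y hy)
  obtain ⟨q, hq, hqb⟩ := approx hg2 hCg h₃ (hga y hy)
  rw [localLTSA_sub_localHLLE]
  have hvol : (vol m M).real (Metric.ball y h) ≤ Cv * volBall m h :=
    ENNReal.toReal_le_of_le_ofReal (mul_nonneg hCv.le (volBall_pos m hh).le) (hv y hy h hh h₄)
  calc _ ≤ ‖restrictBall m M h y (hg2.toLp g) - q‖ * ‖restrictBall m M h y (hf2.toLp f) - p‖ :=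
        abs_inner_residual_le _ _ hp hq
    _ ≤ (Cg * h ^ 3 * √((vol m M).real (Metric.ball y h))) *
        (Cf * h ^ 3 * √((vol m M).real (Metric.ball y h))) := by gcongr
    -- The two square roots combine to one volume, which cancels the normalization `Vol_h` later.
    _ = Cg * Cf * h ^ 6 * (vol m M).real (Metric.ball y h) := by
        have := Real.mul_self_sqrt (measureReal_nonneg (μ := vol m M) (s := Metric.ball y h))
        linear_combination (Cg * Cf * h ^ 6) * this
    _ ≤ Cg * Cf * h ^ 6 * (Cv * volBall m h) := by gcongr
    _ = Cg * Cf * Cv * h ^ 6 * volBall m h := by ring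

end LocalRegression

end ManifoldLearning

/-! ### Integration over `y` and passage to the limit. -/

open ManifoldLearning
theorem theorem3 {d m : ℕ} (M N : Set (Amb d))
    (hM : IsSubmanifoldWithBoundary m M) (hMc : IsCompact M)
    (hN : IsSubmanifold m N) (hMN : M ⊆ N)
    (α : ℝ → ℝ) (hα : α =O[𝓝[>] 0] fun h : ℝ => (h ^ 4)⁻¹)
    (f g : Amb d → ℝ) (hf : SmoothOnSet M f) (hg : SmoothOnSet M g) :
    ∃ (hf2 : MemLp f 2 (vol m M)) (hg2 : MemLp g 2 (vol m M)),
      (∀ᶠ h : ℝ in 𝓝[>] 0,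
        Integrable (fun y => localLTSA m M N h y (hf2.toLp f)) (vol m M) ∧
        Integrable (fun y => localHLLE m M N h y (hf2.toLp f)) (vol m M)) ∧
      Tendsto
        (fun h : ℝ => inner ℝ (hg2.toLp g)
          (opLTSA m M N α h (hf2.toLp f) - opHLLE m M N α h (hf2.toLp f)))
        (𝓝[>] 0) (𝓝 0) ∧
      (∀ l : ℝ,
        Tendsto (fun h : ℝ => inner ℝ (hg2.toLp g) (opLTSA m M N α h (hf2.toLp f)))
            (𝓝[>] 0) (𝓝 l) ↔
          Tendsto (fun h : ℝ => inner ℝ (hg2.toLp g) (opHLLE m M N α h (hf2.toLp f)))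
            (𝓝[>] 0) (𝓝 l)) := by
  have := isFiniteMeasure_vol hN hMc hMN
  have hf2 : MemLp f 2 (vol m M) := hf.memLp hMc
  have hg2 : MemLp g 2 (vol m M) := hg.memLp hMc
  obtain ⟨r, hr, hν⟩ := continuousOn_normalCoord hN hMc hMN
  have hint : ∀ᶠ h : ℝ in 𝓝[>] 0,
      Integrable (fun y => localLTSA m M N h y (hf2.toLp f)) (vol m M) ∧
      Integrable (fun y => localHLLE m M N h y (hf2.toLp f)) (vol m M) := by
    filter_upwards [Ioo_mem_nhdsGT hr] with h hh
    exact ⟨integrable_localLTSA hMc hν hh.2 hf.continuousOn hf2,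
      integrable_localHLLE hMc hν hh.2 _⟩
  obtain ⟨s, hs, C, hC, hloc⟩ := exists_abs_inner_local_sub_le hN hMc hMN hf hg hf2 hg2
  have hlim : Tendsto (fun h : ℝ => inner ℝ (hg2.toLp g)
      (opLTSA m M N α h (hf2.toLp f) - opHLLE m M N α h (hf2.toLp f))) (𝓝[>] 0) (𝓝 0) := by
    obtain ⟨c, hc0, hc⟩ := hα.exists_pos
    have hsq : Tendsto (fun h : ℝ => c * (C * (vol m M).real univ) * h ^ 2) (𝓝[>] 0) (𝓝 0) := by
      have : Continuous fun h : ℝ => c * (C * (vol m M).real univ) * h ^ 2 := by fun_prop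
      exact (this.tendsto' 0 0 (by simp)).mono_left nhdsWithin_le_nhds
    refine squeeze_zero_norm' ?_ hsq
    filter_upwards [hint, hc.bound, Ioo_mem_nhdsGT hs] with h ⟨hi₁, hi₂⟩ hαh ⟨hh0, hhs⟩
    have hV := volBall_pos m hh0
    have hinner := integral_inner (𝕜 := ℝ) (hi₁.sub hi₂) (hg2.toLp g)
    simp only [Pi.sub_apply] at hinner
    rw [opLTSA, opHLLE, ← smul_sub, ← integral_sub hi₁ hi₂, inner_smul_right,
      ← hinner, norm_mul, norm_div, Real.norm_of_nonneg hV.le]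
    have hI : ‖∫ y, inner ℝ (hg2.toLp g) (localLTSA m M N h y (hf2.toLp f) -
        localHLLE m M N h y (hf2.toLp f)) ∂(vol m M)‖ ≤
        C * h ^ 6 * volBall m h * (vol m M).real univ :=
      norm_integral_le_of_norm_le_const ((ae_mem_vol hMc).mono fun y hy => hloc h hh0 hhs y hy)
    rw [Real.norm_of_nonneg (by positivity : 0 ≤ (h ^ 4)⁻¹)] at hαh
    -- The order count: `h⁻⁴ / Vol_h` against `h⁶ Vol_h` leaves `h²`.
    calc _ ≤ c * (h ^ 4)⁻¹ / volBall m h * (C * h ^ 6 * volBall m h * (vol m M).real univ) :=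
          mul_le_mul (by gcongr) hI (norm_nonneg _) (by positivity)
      _ = c * (C * (vol m M).real univ) * h ^ 2 := by
          field_simp
  refine ⟨hf2, hg2, hint, hlim, fun l => ⟨fun hl => ?_, fun hl => ?_⟩⟩
  · have := hl.sub hlim
    simpa [inner_sub_right] using this
  · have := hl.add hlim
    simpa [inner_sub_right] using this
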